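/- **Theorem (Convergence).** Let $T,L>0$ and let $E:[0,T]\times\mathbb R\to\mathbb C$, $N,V:[0,T]\times\mathbb R\to\mathbb R$ be $L$-periodic in $x$, of class $C^5$ jointly in $(t,x)$ on $[0,T]\times\mathbb R$, and a solution of the Zakharov system $$\mathrm i E_t+E_{xx}=NE,\qquad N_t=V_{xx},\qquad V_t=N+|E|^2\qquad(0<t<T,\ x\in\mathbb R),\qquad V(0,0)=0.$$ For positive integers $M,K$ put $\Delta t=T/M$, $\Delta x=L/K$ and, for mesh functions, $$\delta_x^+v_k=\tfrac{v_{k+1}-v_k}{\Delta x},\quad \delta_x^{\langle2\rangle}v_k=\tfrac{v_{k+1}-2v_k+v_{k-1}}{(\Delta x)^2},\quad \delta_t^+u^{(m)}_k=\tfrac{u^{(m+1)}_k-u^{(m)}_k}{\Delta t},\quad \mu_t^+u^{(m)}_k=\tfrac{u^{(m+1)}_k+u^{(m)}_k}{2},\quad \|v\|=\Big(\sum_{k=1}^K|v_k|^2\Delta x\Big)^{1/2}.$$ Let $C_V>0$. Then there are constants $C>0$ and $\varepsilon>0$, not depending on $\Delta t$ and $\Delta x$, such that the following holds whenever $\Delta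 t<\varepsilon$ and $\Delta x<\varepsilon$ (no relation between $\Delta t$ and $\Delta x$ is required). Let $E^{(m)}_k\in\mathbb C$ and $N^{(m)}_k,V^{(m)}_k\in\mathbb R$ ($0\le m\le M$, $k\in\mathbb Z$) be $K$-periodic in $k$ and solve the discrete variational derivative (DVDM) scheme $$\mathrm i\,\delta_t^+E^{(m)}_k=-\delta_x^{\langle2\rangle}\mu_t^+E^{(m)}_k+(\mu_t^+N^{(m)}_k)(\mu_t^+E^{(m)}_k),\qquad \delta_t^+N^{(m)}_k=\delta_x^{\langle2\rangle}\mu_t^+V^{(m)}_k,\qquad \delta_t^+V^{(m)}_k=\mu_t^+N^{(m)}_k+\mu_t^+|E^{(m)}_k|^2$$ for $0\le m<M$, with initial values $E^{(0)}_k=E(0,k\Delta x)$, $N^{(0)}_k=N(0,k\Delta x)$ and $V^{(0)}$ satisfying $\|\delta_x^+(V^{(0)}_k-V(0,k\Delta x))_k\|\le C_V(\Delta x)^2$ (for instance $V^{(0)}_k=V(0,k\Delta x)$). Then, for every $m=0,\dots,M$, the errors $e_{E,k}^{(m)}=E^{(m)}_k-E(m\Delta t,k\Delta x)$, $e_{N,k}^{(m)}=N^{(m)}_k-N(m\Delta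 t,k\Delta x)$, $e_{V,k}^{(m)}=V^{(m)}_k-V(m\Delta t,k\Delta x)$ satisfy $$\|e_E^{(m)}\|^2+\|\delta_x^+e_E^{(m)}\|^2+\|e_N^{(m)}\|^2+\|\delta_x^+e_V^{(m)}\|^2\le C^2\big((\Delta t)^2+(\Delta x)^2\big)^2 .$$ In particular, $$\|e_E^{(m)}\|,\ \|\delta_x^+e_E^{(m)}\|,\ \|e_N^{(m)}\|,\ \|\delta_x^+e_V^{(m)}\|\ \le\ C\big((\Delta t)^2+(\Delta x)^2\big).$$ -/

import Mathlib

noncomputable section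

namespace Zakharov

/-! ### Difference operators, averages and norms on mesh functions -/

section Discrete

variable {F : Type*} [NormedAddCommGroup F] [NormedSpace ℝ F]

/-- Spatial forward difference `δ⁺ₓ v_k = (v_{k+1} - v_k) / Δx`. -/
def dxPlus (dx : ℝ) (v : ℤ → F) (k : ℤ) : F :=
  dx⁻¹ • (v (k + 1) - v k)

/-- Spatial second order central difference
`δ²ₓ v_k = (v_{k+1} - 2 v_k + v_{k-1}) / (Δx)²`. -/
def dxTwo (dx : ℝ) (v : ℤ → F) (k : ℤ) : F :=
  (dx ^ 2)⁻¹ • (v (k + 1) - (2 : ℝ) • v k + v (k - 1))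

/-- Temporal forward difference `δ⁺ₜ u^{(m)}_k = (u^{(m+1)}_k - u^{(m)}_k) / Δt`. -/
def dtPlus (dt : ℝ) (u : ℕ → ℤ → F) (m : ℕ) (k : ℤ) : F :=
  dt⁻¹ • (u (m + 1) k - u m k)

/-- Temporal forward average `μ⁺ₜ u^{(m)}_k = (u^{(m+1)}_k + u^{(m)}_k) / 2`. -/
def mtPlus (u : ℕ → ℤ → F) (m : ℕ) (k : ℤ) : F :=
  (2 : ℝ)⁻¹ • (u (m + 1) k + u m k)

/-- Discrete `L²` norm `‖v‖ = (∑_{k=1}^K |v_k|² Δx)^{1/2}` of a `K`-periodic mesh function. -/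
def meshNorm (dx : ℝ) (K : ℕ) (v : ℤ → F) : ℝ :=
  Real.sqrt (∑ k ∈ Finset.Icc (1 : ℤ) (K : ℤ), ‖v k‖ ^ 2 * dx)

/-- The mesh values `f(m Δt, k Δx)` of a function `f(t, x)`. -/
def sample (dt dx : ℝ) (f : ℝ → ℝ → F) (m : ℕ) (k : ℤ) : F :=
  f ((m : ℝ) * dt) ((k : ℝ) * dx)

end Discrete

/-! ### The Zakharov system -/

/-- `(E, N, V)` is an `L`-periodic solution, on the time interval `[0, T]`, of
`i E_t + E_xx = N E`, `N_t = V_xx`, `V_t = N + |E|²`, `V(0,0) = 0`. -/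
structure IsSolution (T L : ℝ) (E : ℝ → ℝ → ℂ) (N V : ℝ → ℝ → ℝ) : Prop where
  periodic_E : ∀ t ∈ Set.Icc 0 T, ∀ x, E t (x + L) = E t x
  periodic_N : ∀ t ∈ Set.Icc 0 T, ∀ x, N t (x + L) = N t x
  periodic_V : ∀ t ∈ Set.Icc 0 T, ∀ x, V t (x + L) = V t x
  eq_E : ∀ t ∈ Set.Ioo 0 T, ∀ x,
    Complex.I * deriv (fun s => E s x) t + iteratedDeriv 2 (E t) x = (N t x : ℂ) * E t x
  eq_N : ∀ t ∈ Set.Ioo 0 T, ∀ x, deriv (fun s => N s x) t = iteratedDeriv 2 (V t) x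
  eq_V : ∀ t ∈ Set.Ioo 0 T, ∀ x, deriv (fun s => V s x) t = N t x + ‖E t x‖ ^ 2
  V_zero : V 0 0 = 0

/-- `f(t, x)` is of class `C^n` jointly in `(t, x)` on the closed strip `[0, T] × ℝ`. -/
def SmoothOnStrip {F : Type*} [NormedAddCommGroup F] [NormedSpace ℝ F]
    (n : ℕ) (T : ℝ) (f : ℝ → ℝ → F) : Prop :=
  ContDiffOn ℝ n (fun p : ℝ × ℝ => f p.1 p.2) (Set.Icc 0 T ×ˢ Set.univ)

/-! ### The DVDM scheme -/

/-- `(Eₕ, Nₕ, Vₕ)`, with `Eₕ m k` standing for `E^{(m)}_k`, is a `K`-periodic solution of the DVDM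
scheme for the time levels `0, …, M`. -/
structure IsDVDM (dt dx : ℝ) (M K : ℕ) (Eₕ : ℕ → ℤ → ℂ) (Nₕ Vₕ : ℕ → ℤ → ℝ) : Prop where
  periodic_E : ∀ m ≤ M, ∀ k, Eₕ m (k + K) = Eₕ m k
  periodic_N : ∀ m ≤ M, ∀ k, Nₕ m (k + K) = Nₕ m k
  periodic_V : ∀ m ≤ M, ∀ k, Vₕ m (k + K) = Vₕ m k
  eq_E : ∀ m < M, ∀ k,
    Complex.I * dtPlus dt Eₕ m k
      = -dxTwo dx (mtPlus Eₕ m) k + ((mtPlus Nₕ m k : ℝ) : ℂ) * mtPlus Eₕ m k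
  eq_N : ∀ m < M, ∀ k, dtPlus dt Nₕ m k = dxTwo dx (mtPlus Vₕ m) k
  eq_V : ∀ m < M, ∀ k,
    dtPlus dt Vₕ m k = mtPlus Nₕ m k + mtPlus (fun j l => ‖Eₕ j l‖ ^ 2) m k

/-- The error functional
`‖e_E‖² + ‖δ⁺ₓ e_E‖² + ‖e_N‖² + ‖δ⁺ₓ e_V‖²` of mesh functions `e_E`, `e_N`, `e_V`. -/
def errorFunctional (dx : ℝ) (K : ℕ) (eE : ℤ → ℂ) (eN eV : ℤ → ℝ) : ℝ :=
  meshNorm dx K eE ^ 2 + meshNorm dx K (dxPlus dx eE) ^ 2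
    + meshNorm dx K eN ^ 2 + meshNorm dx K (dxPlus dx eV) ^ 2

end Zakharov

end

/-!
The energy of `u` relative to `w`, which is the conserved energy of the scheme at `u` minus its
first order Taylor polynomial at `w`, changes in one time step only through the residuals of `u` and
`w` and through terms of second order in `u - w`, so that Gronwall's inequality yields stability.
With `u` the solution of the scheme and `w` the mesh values of the exact solution the residuals are
of size `Δt² + Δx²`, by Taylor expansion about the midpoint of the time step. The relative energy
becomes coercive, up to a multiple of the relative mass, as soon as `E` is bounded uniformly in the
mesh: such a bound follows from conservation of mass and energy through a discrete
Gagliardo–Nirenberg inequality, and this is why no relation between `Δt` and `Δx` is needed.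
-/

noncomputable section

namespace Zakharov

open Function

section MeshSum

/-- The Riemann sum `∑_{k=1}^K g_k Δx` of a mesh function over one period. -/
def meshSum (dx : ℝ) (K : ℕ) (g : ℤ → ℝ) : ℝ :=
  ∑ k ∈ Finset.Icc (1 : ℤ) (K : ℤ), g k * dx

variable {dx : ℝ} {K : ℕ}

theorem sum_Icc_one_natCast (K : ℕ) (f : ℤ → ℝ) :
    ∑ k ∈ Finset.Icc (1 : ℤ) (K : ℤ), f k = ∑ i ∈ Finset.range K, f ((i : ℤ) + 1) := by
  induction K with
  | zero => simp
  | succ K ih =>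
    have hinsert : Finset.Icc (1 : ℤ) ((K + 1 : ℕ) : ℤ)
        = insert ((K : ℤ) + 1) (Finset.Icc (1 : ℤ) (K : ℤ)) := by
      ext; simp only [Finset.mem_Icc, Finset.mem_insert]; lia
    rw [Finset.sum_range_succ, ← ih, hinsert, Finset.sum_insert (by simp), add_comm]

theorem meshSum_add (f g : ℤ → ℝ) :
    meshSum dx K (fun k => f k + g k) = meshSum dx K f + meshSum dx K g := by
  simp only [meshSum, add_mul, Finset.sum_add_distrib]

theorem meshSum_sub (f g : ℤ → ℝ) :
    meshSum dx K (fun k => f k - g k) = meshSum dx K f - meshSum dx K g := by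
  simp only [meshSum, sub_mul, Finset.sum_sub_distrib]

theorem meshSum_const_mul (c : ℝ) (f : ℤ → ℝ) :
    meshSum dx K (fun k => c * f k) = c * meshSum dx K f := by
  simp only [meshSum, Finset.mul_sum, mul_assoc]

theorem meshSum_const (c : ℝ) : meshSum dx K (fun _ => c) = K * dx * c := by
  simp only [meshSum, Finset.sum_const, Int.card_Icc, add_sub_cancel_right, Int.toNat_natCast,
    nsmul_eq_mul]
  ring

theorem meshSum_mono (hdx : 0 ≤ dx) {f g : ℤ → ℝ} (hfg : ∀ k, f k ≤ g k) :
    meshSum dx K f ≤ meshSum dx K g :=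
  Finset.sum_le_sum fun k _ => mul_le_mul_of_nonneg_right (hfg k) hdx

theorem meshSum_nonneg (hdx : 0 ≤ dx) {f : ℤ → ℝ} (hf : ∀ k, 0 ≤ f k) : 0 ≤ meshSum dx K f :=
  Finset.sum_nonneg fun k _ => mul_nonneg (hf k) hdx

theorem meshSum_forward_diff {f : ℤ → ℝ} (hf : Periodic f (K : ℤ)) :
    meshSum dx K (fun k => f (k + 1) - f k) = 0 := by
  have htele := Finset.sum_range_sub (fun i : ℕ => f ((i : ℤ) + 1)) K
  rw [Nat.cast_zero, zero_add, add_comm (K : ℤ) 1, hf 1, sub_self] at htele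
  rw [meshSum, ← Finset.sum_mul, sum_Icc_one_natCast]
  push_cast at htele
  rw [htele, zero_mul]

theorem meshSum_shift {f : ℤ → ℝ} (hf : Periodic f (K : ℤ)) :
    meshSum dx K (fun k => f (k + 1)) = meshSum dx K f :=
  sub_eq_zero.1 ((meshSum_sub _ _).symm.trans (meshSum_forward_diff hf))

theorem meshSum_dtPlus (dt : ℝ) (g : ℕ → ℤ → ℝ) (m : ℕ) :
    meshSum dx K (dtPlus dt g m) = dt⁻¹ * (meshSum dx K (g (m + 1)) - meshSum dx K (g m)) := by
  rw [← meshSum_sub, ← meshSum_const_mul]; rfl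

theorem abs_sub_le_sum_abs_forward_diff {f : ℤ → ℝ} {i j : ℤ} (hi : i ∈ Set.Icc 1 (K : ℤ))
    (hj : j ∈ Set.Icc 1 (K : ℤ)) :
    |f j - f i| ≤ ∑ k ∈ Finset.Icc (1 : ℤ) (K : ℤ), |f (k + 1) - f k| := by
  wlog hij : i ≤ j generalizing i j
  · rw [abs_sub_comm]
    exact this hj hi (le_of_not_ge hij)
  obtain ⟨p, rfl⟩ : ∃ p : ℕ, i = p + 1 := ⟨(i - 1).toNat, by grind⟩
  obtain ⟨q, rfl⟩ : ∃ q : ℕ, j = q + 1 := ⟨(j - 1).toNat, by grind⟩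
  have hpath := dist_le_Ico_sum_dist (fun l : ℕ => f (l + 1)) (show p ≤ q by lia)
  simp only [Real.dist_eq, abs_sub_comm (f (_ + 1)) (f (_ + 1 + 1)), Nat.cast_add,
    Nat.cast_one] at hpath
  rw [abs_sub_comm] at hpath
  rw [sum_Icc_one_natCast]
  refine hpath.trans (Finset.sum_le_sum_of_subset_of_nonneg (fun l hl => ?_)
    fun _ _ _ => abs_nonneg _)
  have := hj.2
  simp only [Finset.mem_Ico, Finset.mem_range] at hl ⊢
  lia

end MeshSum

section MeshNorm

variable {F : Type*} [NormedAddCommGroup F] {dx : ℝ} {K : ℕ}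

theorem meshNorm_nonneg (v : ℤ → F) : 0 ≤ meshNorm dx K v :=
  Real.sqrt_nonneg _

theorem meshNorm_sq (hdx : 0 ≤ dx) (v : ℤ → F) :
    meshNorm dx K v ^ 2 = meshSum dx K (fun k => ‖v k‖ ^ 2) :=
  Real.sq_sqrt (Finset.sum_nonneg fun _ _ => mul_nonneg (sq_nonneg _) hdx)

theorem meshSum_norm_mul_norm_le (hdx : 0 ≤ dx) {G : Type*} [NormedAddCommGroup G]
    (f : ℤ → F) (g : ℤ → G) :
    meshSum dx K (fun k => ‖f k‖ * ‖g k‖) ≤ meshNorm dx K f * meshNorm dx K g := by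
  have hcs := Real.sum_mul_le_sqrt_mul_sqrt (Finset.Icc (1 : ℤ) (K : ℤ))
    (fun k => ‖f k‖ * √dx) (fun k => ‖g k‖ * √dx)
  simp only [mul_pow, Real.sq_sqrt hdx] at hcs
  refine (Finset.sum_congr rfl fun k _ => ?_).trans_le hcs
  rw [mul_mul_mul_comm, Real.mul_self_sqrt hdx]

variable [NormedSpace ℝ F]

theorem norm_dxPlus_mul (hdx : 0 < dx) (v : ℤ → F) (k : ℤ) :
    ‖dxPlus dx v k‖ * dx = ‖v (k + 1) - v k‖ := by
  rw [dxPlus, norm_smul, norm_inv, Real.norm_of_nonneg hdx.le, mul_right_comm,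
    inv_mul_cancel₀ hdx.ne', one_mul]

theorem sum_abs_forward_diff_norm_sq_le (hdx : 0 < dx) {v : ℤ → F} (hv : Periodic v (K : ℤ)) :
    ∑ k ∈ Finset.Icc (1 : ℤ) (K : ℤ), |‖v (k + 1)‖ ^ 2 - ‖v k‖ ^ 2|
      ≤ 2 * (meshNorm dx K v * meshNorm dx K (dxPlus dx v)) := by
  have hshift : meshNorm dx K (fun k => v (k + 1)) = meshNorm dx K v :=
    congrArg Real.sqrt (meshSum_shift (f := fun k => ‖v k‖ ^ 2) fun k => by simp only [hv k])
  calc ∑ k ∈ Finset.Icc (1 : ℤ) (K : ℤ), |‖v (k + 1)‖ ^ 2 - ‖v k‖ ^ 2|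
      ≤ meshSum dx K (fun k => ‖v (k + 1)‖ * ‖dxPlus dx v k‖ + ‖v k‖ * ‖dxPlus dx v k‖) := by
        refine Finset.sum_le_sum fun k _ => ?_
        beta_reduce
        rw [← add_mul, mul_assoc, norm_dxPlus_mul hdx, sq_sub_sq, abs_mul,
          abs_of_nonneg (by positivity)]
        exact mul_le_mul_of_nonneg_left (abs_norm_sub_norm_le _ _) (by positivity)
    _ ≤ meshNorm dx K (fun k => v (k + 1)) * meshNorm dx K (dxPlus dx v)
          + meshNorm dx K v * meshNorm dx K (dxPlus dx v) := by
        rw [meshSum_add]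
        exact add_le_add (meshSum_norm_mul_norm_le hdx.le (fun k => v (k + 1)) _)
          (meshSum_norm_mul_norm_le hdx.le _ _)
    _ = 2 * (meshNorm dx K v * meshNorm dx K (dxPlus dx v)) := by rw [hshift, two_mul]

theorem discrete_gagliardo_nirenberg (hdx : 0 < dx) (hK : 0 < K) {v : ℤ → F}
    (hv : Periodic v (K : ℤ)) (j : ℤ) :
    ‖v j‖ ^ 2 ≤ (K * dx)⁻¹ * meshNorm dx K v ^ 2
      + 2 * (meshNorm dx K v * meshNorm dx K (dxPlus dx v)) := by
  obtain ⟨i, hi, hji⟩ := hv.exists_mem_Ioc (Nat.cast_pos.2 hK) j 0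
  have hosc : ∀ k ∈ Finset.Icc (1 : ℤ) (K : ℤ),
      ‖v j‖ ^ 2 - 2 * (meshNorm dx K v * meshNorm dx K (dxPlus dx v)) ≤ ‖v k‖ ^ 2 := by
    intro k hk
    have htv := (abs_sub_le_sum_abs_forward_diff (f := fun l => ‖v l‖ ^ 2) (j := i)
      (Finset.mem_Icc.1 hk) (by grind)).trans (sum_abs_forward_diff_norm_sq_le hdx hv)
    rw [hji]
    linarith [le_abs_self (‖v i‖ ^ 2 - ‖v k‖ ^ 2)]
  have hsum : K * dx * (‖v j‖ ^ 2 - 2 * (meshNorm dx K v * meshNorm dx K (dxPlus dx v)))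
      ≤ meshNorm dx K v ^ 2 := by
    rw [← meshSum_const, meshNorm_sq hdx.le]
    exact Finset.sum_le_sum fun k hk => mul_le_mul_of_nonneg_right (hosc k hk) hdx.le
  rw [← sub_le_iff_le_add, inv_mul_eq_div, le_div_iff₀' (by positivity)]
  exact hsum

end MeshNorm

section DifferenceCalculus

variable {F : Type*} [NormedAddCommGroup F] [NormedSpace ℝ F]

theorem dxPlus_sub (dx : ℝ) (u v : ℤ → F) (k : ℤ) :
    dxPlus dx (u - v) k = dxPlus dx u k - dxPlus dx v k := by
  simp only [dxPlus, Pi.sub_apply]; module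

theorem dxTwo_sub (dx : ℝ) (u v : ℤ → F) (k : ℤ) :
    dxTwo dx (u - v) k = dxTwo dx u k - dxTwo dx v k := by
  simp only [dxTwo, Pi.sub_apply]; module

theorem dtPlus_sub (dt : ℝ) (u v : ℕ → ℤ → F) (m : ℕ) (k : ℤ) :
    dtPlus dt (u - v) m k = dtPlus dt u m k - dtPlus dt v m k := by
  simp only [dtPlus, Pi.sub_apply]; module

theorem mtPlus_sub (u v : ℕ → ℤ → F) (m : ℕ) :
    mtPlus (u - v) m = mtPlus u m - mtPlus v m := by
  funext k; simp only [mtPlus, Pi.sub_apply]; module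

theorem dxPlus_mtPlus (dx : ℝ) (u : ℕ → ℤ → F) (m : ℕ) (k : ℤ) :
    dxPlus dx (mtPlus u m) k = mtPlus (fun j => dxPlus dx (u j)) m k := by
  simp only [dxPlus, mtPlus]; module

theorem dxPlus_dtPlus (dx dt : ℝ) (u : ℕ → ℤ → F) (m : ℕ) (k : ℤ) :
    dxPlus dx (dtPlus dt u m) k = dtPlus dt (fun j => dxPlus dx (u j)) m k := by
  simp only [dxPlus, dtPlus]; module

theorem norm_mtPlus_le {u : ℕ → ℤ → F} {c : ℝ} {m : ℕ} {k : ℤ} (h₀ : ‖u m k‖ ≤ c)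
    (h₁ : ‖u (m + 1) k‖ ≤ c) : ‖mtPlus u m k‖ ≤ c := by
  rw [mtPlus, norm_smul, norm_inv, Real.norm_two]
  linarith [norm_add_le (u (m + 1) k) (u m k)]

theorem periodic_dxTwo {K : ℕ} {u : ℤ → F} (hu : Periodic u (K : ℤ)) (dx : ℝ) :
    Periodic (dxTwo dx u) (K : ℤ) := fun k => by
  simp only [dxTwo, add_right_comm k (K : ℤ) 1, ← sub_add_eq_add_sub k 1 (K : ℤ), hu _]

theorem periodic_mtPlus {K m : ℕ} {u : ℕ → ℤ → F} (h₀ : Periodic (u m) (K : ℤ))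
    (h₁ : Periodic (u (m + 1)) (K : ℤ)) : Periodic (mtPlus u m) (K : ℤ) := fun k => by
  simp only [mtPlus, h₀ k, h₁ k]

theorem periodic_dtPlus {K m : ℕ} {u : ℕ → ℤ → F} (h₀ : Periodic (u m) (K : ℤ))
    (h₁ : Periodic (u (m + 1)) (K : ℤ)) (dt : ℝ) : Periodic (dtPlus dt u m) (K : ℤ) := fun k => by
  simp only [dtPlus, h₀ k, h₁ k]

theorem dtPlus_mul (dt : ℝ) (f g : ℕ → ℤ → ℝ) (m : ℕ) (k : ℤ) :
    dtPlus dt (fun j l => f j l * g j l) m k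
      = dtPlus dt f m k * mtPlus g m k + mtPlus f m k * dtPlus dt g m k := by
  simp only [dtPlus, mtPlus, smul_eq_mul]; ring

theorem dtPlus_sq_div_two (dt : ℝ) (f : ℕ → ℤ → ℝ) (m : ℕ) (k : ℤ) :
    dtPlus dt (fun j l => f j l ^ 2 / 2) m k = dtPlus dt f m k * mtPlus f m k := by
  simp only [dtPlus, mtPlus, smul_eq_mul]; ring

end DifferenceCalculus

section InnerProduct

variable {F : Type*} [NormedAddCommGroup F] [InnerProductSpace ℝ F]

theorem dtPlus_inner (dt : ℝ) (u v : ℕ → ℤ → F) (m : ℕ) (k : ℤ) :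
    dtPlus dt (fun j l => inner ℝ (u j l) (v j l)) m k
      = inner ℝ (dtPlus dt u m k) (mtPlus v m k) + inner ℝ (mtPlus u m k) (dtPlus dt v m k) := by
  simp only [dtPlus, mtPlus, smul_eq_mul, real_inner_smul_left, real_inner_smul_right,
    inner_sub_left, inner_sub_right, inner_add_left, inner_add_right]
  ring

theorem dtPlus_norm_sq (dt : ℝ) (u : ℕ → ℤ → F) (m : ℕ) (k : ℤ) :
    dtPlus dt (fun j l => ‖u j l‖ ^ 2) m k = 2 * inner ℝ (dtPlus dt u m k) (mtPlus u m k) := by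
  simp only [← real_inner_self_eq_norm_sq]
  rw [dtPlus_inner, real_inner_comm (dtPlus dt u m k), two_mul]

/-- The density whose sum over a period vanishes by summation by parts. -/
def greenDefect (dx : ℝ) (b u : ℤ → F) (k : ℤ) : ℝ :=
  inner ℝ (b k) (dxTwo dx u k) + inner ℝ (dxPlus dx b k) (dxPlus dx u k)

theorem meshSum_greenDefect {K : ℕ} {b u : ℤ → F} (hb : Periodic b (K : ℤ))
    (hu : Periodic u (K : ℤ)) (dx : ℝ) : meshSum dx K (greenDefect dx b u) = 0 := by
  have hflux : Periodic (fun k => (dx ^ 2)⁻¹ * inner ℝ (b k) (u k - u (k - 1))) (K : ℤ) :=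
    fun k => by simp only [hb k, ← sub_add_eq_add_sub k 1 (K : ℤ), hu _]
  rw [← meshSum_forward_diff (dx := dx) hflux]
  congr 1
  funext k
  simp only [greenDefect, dxTwo, dxPlus, real_inner_smul_left, real_inner_smul_right,
    inner_sub_left, inner_sub_right, inner_add_right, add_sub_cancel_right]
  ring

theorem inner_I_mul_left (z w : ℂ) : inner ℝ (Complex.I * z) w = -inner ℝ z (Complex.I * w) := by
  simp only [Complex.inner, map_mul, Complex.conj_I, ← Complex.neg_re]
  ring_nf

theorem inner_I_mul_self (z : ℂ) : inner ℝ (Complex.I * z) z = 0 := by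
  linarith [inner_I_mul_left z z, real_inner_comm z (Complex.I * z)]

theorem inner_eq_of_I_mul_add_eq {z y f r : ℂ} (h : Complex.I * z + y = f + r) :
    inner ℝ z y = inner ℝ z f + inner ℝ (Complex.I * r) (f - y) := by
  have hy : y = f + (r - Complex.I * z) := by linear_combination h
  have hIz : inner ℝ z (Complex.I * z) = 0 := by rw [real_inner_comm, inner_I_mul_self]
  have hunitary : inner ℝ (Complex.I * r) (Complex.I * z) = inner ℝ z r := by
    rw [inner_I_mul_left, ← mul_assoc, Complex.I_mul_I, neg_one_mul, inner_neg_right, neg_neg,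
      real_inner_comm]
  rw [hy, sub_add_cancel_left, neg_sub, inner_add_right, inner_sub_right, inner_sub_right, hIz,
    hunitary, inner_I_mul_self]

end InnerProduct

/-- A triple `(E, N, V)` of mesh functions of the time level and the mesh point, which need not
satisfy any equation. -/
@[ext]
structure MeshTriple where
  E : ℕ → ℤ → ℂ
  N : ℕ → ℤ → ℝ
  V : ℕ → ℤ → ℝ

namespace MeshTriple

instance : Zero MeshTriple := ⟨⟨0, 0, 0⟩⟩

instance : Sub MeshTriple := ⟨fun u w => ⟨u.E - w.E, u.N - w.N, u.V - w.V⟩⟩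

/-- `K`-periodicity in space at the time level `m`. -/
structure PeriodicAt (u : MeshTriple) (K m : ℕ) : Prop where
  E : Periodic (u.E m) (K : ℤ)
  N : Periodic (u.N m) (K : ℤ)
  V : Periodic (u.V m) (K : ℤ)

/-- The residual of the triple in the Schrödinger equation of the scheme. -/
def residualE (dt dx : ℝ) (u : MeshTriple) (m : ℕ) (k : ℤ) : ℂ :=
  Complex.I * dtPlus dt u.E m k + dxTwo dx (mtPlus u.E m) k - mtPlus u.N m k • mtPlus u.E m k

/-- The residual of the triple in the equation of the scheme for `N`. -/
def residualN (dt dx : ℝ) (u : MeshTriple) (m : ℕ) (k : ℤ) : ℝ :=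
  dtPlus dt u.N m k - dxTwo dx (mtPlus u.V m) k

/-- The residual of the triple in the equation of the scheme for `V`. -/
def residualV (dt : ℝ) (u : MeshTriple) (m : ℕ) (k : ℤ) : ℝ :=
  dtPlus dt u.V m k - mtPlus u.N m k - mtPlus (fun j l => ‖u.E j l‖ ^ 2) m k

/-- The difference of the residuals in the Schrödinger equation. -/
def gapE (dt dx : ℝ) (u w : MeshTriple) (m : ℕ) : ℤ → ℂ :=
  residualE dt dx u m - residualE dt dx w m

/-- The difference of the residuals in the equation for `N`. -/
def gapN (dt dx : ℝ) (u w : MeshTriple) (m : ℕ) : ℤ → ℝ :=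
  residualN dt dx u m - residualN dt dx w m

/-- The difference of the residuals in the equation for `V`. -/
def gapV (dt : ℝ) (u w : MeshTriple) (m : ℕ) : ℤ → ℝ :=
  residualV dt u m - residualV dt w m

/-- The difference of the intensities `|E|²`. -/
def gapSq (u w : MeshTriple) (m : ℕ) (k : ℤ) : ℝ :=
  ‖u.E m k‖ ^ 2 - ‖w.E m k‖ ^ 2

/-- The difference of the nonlinear terms `(μN)(μE)`, in a form that shows the factor `u - w`. -/
def gapNE (u w : MeshTriple) (m : ℕ) (k : ℤ) : ℂ :=
  mtPlus w.N m k • mtPlus (u - w).E m k + mtPlus (u - w).N m k • mtPlus u.E m k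

/-- The density of the energy of `u` relative to `w`: the energy of the scheme at `u` minus its
first order Taylor polynomial at `w`; for `w = 0` it is the conserved energy of the scheme. -/
def energyDensity (dx : ℝ) (u w : MeshTriple) (m : ℕ) (k : ℤ) : ℝ :=
  ‖dxPlus dx ((u - w).E m) k‖ ^ 2 + (u - w).N m k ^ 2 / 2 + dxPlus dx ((u - w).V m) k ^ 2 / 2
    + (u - w).N m k * gapSq u w m k + w.N m k * ‖(u - w).E m k‖ ^ 2

/-- The rate of change of `energyDensity`, up to terms that sum to zero over a period. -/
def energyRate (dt dx : ℝ) (u w : MeshTriple) (m : ℕ) (k : ℤ) : ℝ :=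
  -2 * inner ℝ (Complex.I * dxPlus dx (gapE dt dx u w m) k) (dxPlus dx (mtPlus (u - w).E m) k)
    - 2 * inner ℝ (Complex.I * gapE dt dx u w m k) (gapNE u w m k)
    + gapN dt dx u w m k * (mtPlus (u - w).N m k + mtPlus (gapSq u w) m k)
    + dxPlus dx (gapV dt u w m) k * dxPlus dx (mtPlus (u - w).V m) k
    + 2 * mtPlus (u - w).N m k * inner ℝ (dtPlus dt w.E m k) (mtPlus (u - w).E m k)
    + dtPlus dt w.N m k * mtPlus (fun j l => ‖(u - w).E j l‖ ^ 2) m k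

/-- The rate of change of `|u.E - w.E|²`, up to terms that sum to zero over a period. -/
def massRate (dt dx : ℝ) (u w : MeshTriple) (m : ℕ) (k : ℤ) : ℝ :=
  -2 * inner ℝ (Complex.I * (mtPlus (u - w).N m k • mtPlus u.E m k + gapE dt dx u w m k))
    (mtPlus (u - w).E m k)

/-- The energy of `u` relative to `w`. -/
def energy (dx : ℝ) (K : ℕ) (u w : MeshTriple) (m : ℕ) : ℝ :=
  meshSum dx K (energyDensity dx u w m)

/-- The mass of `u` relative to `w`. -/
def mass (dx : ℝ) (K : ℕ) (u w : MeshTriple) (m : ℕ) : ℝ :=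
  meshNorm dx K ((u - w).E m) ^ 2

variable {dt dx : ℝ} {K m : ℕ} {u w : MeshTriple}

theorem zero_E : (0 : MeshTriple).E = 0 := rfl

theorem zero_N : (0 : MeshTriple).N = 0 := rfl

theorem zero_V : (0 : MeshTriple).V = 0 := rfl

theorem sub_E (u w : MeshTriple) : (u - w).E = u.E - w.E := rfl

theorem sub_N (u w : MeshTriple) : (u - w).N = u.N - w.N := rfl

theorem sub_V (u w : MeshTriple) : (u - w).V = u.V - w.V := rfl

protected theorem sub_zero (u : MeshTriple) : u - 0 = u :=
  MeshTriple.ext (sub_zero u.E) (sub_zero u.N) (sub_zero u.V)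

theorem periodicAt_zero (K m : ℕ) : PeriodicAt 0 K m := ⟨fun _ => rfl, fun _ => rfl, fun _ => rfl⟩

theorem PeriodicAt.sub (hu : u.PeriodicAt K m) (hw : w.PeriodicAt K m) : (u - w).PeriodicAt K m :=
  ⟨hu.E.sub hw.E, hu.N.sub hw.N, hu.V.sub hw.V⟩

theorem PeriodicAt.residualE (hu : u.PeriodicAt K m) (hu' : u.PeriodicAt K (m + 1)) (dt dx : ℝ) :
    Periodic (residualE dt dx u m) (K : ℤ) := fun k => by
  simp only [MeshTriple.residualE, periodic_dtPlus hu.E hu'.E dt k,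
    periodic_dxTwo (periodic_mtPlus hu.E hu'.E) dx k, periodic_mtPlus hu.E hu'.E k,
    periodic_mtPlus hu.N hu'.N k]

theorem PeriodicAt.residualV (hu : u.PeriodicAt K m) (hu' : u.PeriodicAt K (m + 1)) (dt : ℝ) :
    Periodic (residualV dt u m) (K : ℤ) := fun k => by
  simp only [MeshTriple.residualV, mtPlus, periodic_dtPlus hu.V hu'.V dt k, hu.N k, hu'.N k,
    hu.E k, hu'.E k]

theorem schrodinger_gap (dt dx : ℝ) (u w : MeshTriple) (m : ℕ) (k : ℤ) :
    Complex.I * dtPlus dt (u - w).E m k + dxTwo dx (mtPlus (u - w).E m) k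
      = gapNE u w m k + gapE dt dx u w m k := by
  simp only [gapNE, gapE, residualE, sub_E, sub_N, mtPlus_sub, dtPlus_sub, dxTwo_sub, Pi.sub_apply,
    mul_sub]
  module

theorem wave_gap_N (dt dx : ℝ) (u w : MeshTriple) (m : ℕ) (k : ℤ) :
    dtPlus dt (u - w).N m k = dxTwo dx (mtPlus (u - w).V m) k + gapN dt dx u w m k := by
  simp only [gapN, residualN, sub_N, sub_V, mtPlus_sub, dtPlus_sub, dxTwo_sub, Pi.sub_apply]
  ring

theorem mtPlus_gapSq (u w : MeshTriple) (m : ℕ) (k : ℤ) :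
    mtPlus (gapSq u w) m k
      = mtPlus (fun j l => ‖u.E j l‖ ^ 2) m k - mtPlus (fun j l => ‖w.E j l‖ ^ 2) m k := by
  simp only [mtPlus, gapSq]; module

theorem wave_gap_V (dt : ℝ) (u w : MeshTriple) (m : ℕ) (k : ℤ) :
    dtPlus dt (u - w).V m k
      = mtPlus (u - w).N m k + mtPlus (gapSq u w) m k + gapV dt u w m k := by
  simp only [gapV, residualV, sub_N, sub_V, mtPlus_gapSq, mtPlus_sub, dtPlus_sub, Pi.sub_apply]
  ring

theorem dtPlus_gapSq (dt : ℝ) (u w : MeshTriple) (m : ℕ) (k : ℤ) :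
    dtPlus dt (gapSq u w) m k = 2 * inner ℝ (dtPlus dt (u - w).E m k) (mtPlus u.E m k)
      + 2 * inner ℝ (dtPlus dt w.E m k) (mtPlus (u - w).E m k) := by
  have hsub : dtPlus dt (gapSq u w) m k
      = dtPlus dt (fun j l => ‖u.E j l‖ ^ 2) m k - dtPlus dt (fun j l => ‖w.E j l‖ ^ 2) m k := by
    simp only [dtPlus, gapSq]; module
  rw [hsub, dtPlus_norm_sq, dtPlus_norm_sq, sub_E, dtPlus_sub, mtPlus_sub, Pi.sub_apply,
    inner_sub_left, inner_sub_right]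
  ring

theorem dtPlus_dirichlet_E (dt dx : ℝ) (u w : MeshTriple) (m : ℕ) (k : ℤ) :
    dtPlus dt (fun j l => ‖dxPlus dx ((u - w).E j) l‖ ^ 2) m k
      = 2 * greenDefect dx (dtPlus dt (u - w).E m) (mtPlus (u - w).E m) k
        + 2 * greenDefect dx (fun l => Complex.I * gapE dt dx u w m l) (mtPlus (u - w).E m) k
        - 2 * inner ℝ (dtPlus dt (u - w).E m k) (gapNE u w m k)
        - 2 * inner ℝ (Complex.I * gapE dt dx u w m k) (gapNE u w m k)
        - 2 * inner ℝ (Complex.I * dxPlus dx (gapE dt dx u w m) k)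
          (dxPlus dx (mtPlus (u - w).E m) k) := by
  have hI : dxPlus dx (fun l => Complex.I * gapE dt dx u w m l) k
      = Complex.I * dxPlus dx (gapE dt dx u w m) k := by
    simp only [dxPlus, mul_smul_comm, mul_sub]
  have heq := inner_eq_of_I_mul_add_eq (schrodinger_gap dt dx u w m k)
  rw [inner_sub_right] at heq
  rw [dtPlus_norm_sq dt (fun j l => dxPlus dx ((u - w).E j) l), ← dxPlus_dtPlus, ← dxPlus_mtPlus,
    greenDefect, greenDefect, hI]
  linear_combination -2 * heq

theorem dtPlus_wave_energy (dt dx : ℝ) (u w : MeshTriple) (m : ℕ) (k : ℤ) :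
    dtPlus dt (fun j l => (u - w).N j l ^ 2 / 2) m k
        + dtPlus dt (fun j l => dxPlus dx ((u - w).V j) l ^ 2 / 2) m k
      = greenDefect dx (dtPlus dt (u - w).V m) (mtPlus (u - w).V m) k
        - greenDefect dx (gapV dt u w m) (mtPlus (u - w).V m) k
        - dtPlus dt (u - w).N m k * mtPlus (gapSq u w) m k
        + gapN dt dx u w m k * (mtPlus (u - w).N m k + mtPlus (gapSq u w) m k)
        + dxPlus dx (gapV dt u w m) k * dxPlus dx (mtPlus (u - w).V m) k := by
  rw [dtPlus_sq_div_two, dtPlus_sq_div_two dt (fun j l => dxPlus dx ((u - w).V j) l),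
    ← dxPlus_dtPlus, ← dxPlus_mtPlus]
  simp only [greenDefect, RCLike.inner_apply, conj_trivial]
  linear_combination (mtPlus (u - w).N m k + mtPlus (gapSq u w) m k) * wave_gap_N dt dx u w m k
    - dxTwo dx (mtPlus (u - w).V m) k * wave_gap_V dt u w m k

theorem dtPlus_coupling_energy (dt : ℝ) (u w : MeshTriple) (m : ℕ) (k : ℤ) :
    dtPlus dt (fun j l => (u - w).N j l * gapSq u w j l) m k
        + dtPlus dt (fun j l => w.N j l * ‖(u - w).E j l‖ ^ 2) m k
      = dtPlus dt (u - w).N m k * mtPlus (gapSq u w) m k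
        + 2 * inner ℝ (dtPlus dt (u - w).E m k) (gapNE u w m k)
        + 2 * mtPlus (u - w).N m k * inner ℝ (dtPlus dt w.E m k) (mtPlus (u - w).E m k)
        + dtPlus dt w.N m k * mtPlus (fun j l => ‖(u - w).E j l‖ ^ 2) m k := by
  rw [dtPlus_mul, dtPlus_mul dt w.N (fun j l => ‖(u - w).E j l‖ ^ 2), dtPlus_norm_sq, dtPlus_gapSq,
    gapNE, inner_add_right, real_inner_smul_right, real_inner_smul_right]
  ring

theorem dtPlus_energyDensity (dt dx : ℝ) (u w : MeshTriple) (m : ℕ) (k : ℤ) :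
    dtPlus dt (energyDensity dx u w) m k = energyRate dt dx u w m k
      + (2 * greenDefect dx (dtPlus dt (u - w).E m) (mtPlus (u - w).E m) k
        + 2 * greenDefect dx (fun l => Complex.I * gapE dt dx u w m l) (mtPlus (u - w).E m) k
        + (greenDefect dx (dtPlus dt (u - w).V m) (mtPlus (u - w).V m) k
          - greenDefect dx (gapV dt u w m) (mtPlus (u - w).V m) k)) := by
  have hsplit : dtPlus dt (energyDensity dx u w) m k
      = dtPlus dt (fun j l => ‖dxPlus dx ((u - w).E j) l‖ ^ 2) m k
        + (dtPlus dt (fun j l => (u - w).N j l ^ 2 / 2) m k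
          + dtPlus dt (fun j l => dxPlus dx ((u - w).V j) l ^ 2 / 2) m k)
        + (dtPlus dt (fun j l => (u - w).N j l * gapSq u w j l) m k
          + dtPlus dt (fun j l => w.N j l * ‖(u - w).E j l‖ ^ 2) m k) := by
    simp only [dtPlus, energyDensity]; module
  rw [hsplit, dtPlus_dirichlet_E, dtPlus_wave_energy, dtPlus_coupling_energy, energyRate]
  ring

theorem energy_step (hu : u.PeriodicAt K m) (hu' : u.PeriodicAt K (m + 1)) (hw : w.PeriodicAt K m)
    (hw' : w.PeriodicAt K (m + 1)) (dt dx : ℝ) :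
    dt⁻¹ * (energy dx K u w (m + 1) - energy dx K u w m)
      = meshSum dx K (energyRate dt dx u w m) := by
  have ha := (hu.sub hw).E
  have ha' := (hu'.sub hw').E
  have hv := (hu.sub hw).V
  have hv' := (hu'.sub hw').V
  have hgapE : Periodic (gapE dt dx u w m) (K : ℤ) :=
    (hu.residualE hu' dt dx).sub (hw.residualE hw' dt dx)
  have hgapV : Periodic (gapV dt u w m) (K : ℤ) := (hu.residualV hu' dt).sub (hw.residualV hw' dt)
  rw [energy, energy, ← meshSum_dtPlus, funext (dtPlus_energyDensity dt dx u w m)]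
  simp only [meshSum_add, meshSum_sub, meshSum_const_mul]
  rw [meshSum_greenDefect (periodic_dtPlus ha ha' dt) (periodic_mtPlus ha ha'),
    meshSum_greenDefect (fun k => by rw [hgapE k]) (periodic_mtPlus ha ha'),
    meshSum_greenDefect (periodic_dtPlus hv hv' dt) (periodic_mtPlus hv hv'),
    meshSum_greenDefect hgapV (periodic_mtPlus hv hv')]
  ring

theorem dtPlus_mass_density (dt dx : ℝ) (u w : MeshTriple) (m : ℕ) (k : ℤ) :
    dtPlus dt (fun j l => ‖(u - w).E j l‖ ^ 2) m k = massRate dt dx u w m k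
      - 2 * greenDefect dx (fun l => Complex.I * mtPlus (u - w).E m l) (mtPlus (u - w).E m) k := by
  set a := mtPlus (u - w).E m
  have heq : dtPlus dt (u - w).E m k = Complex.I * dxTwo dx a k
      - (mtPlus w.N m k • (Complex.I * a k)
        + Complex.I * (mtPlus (u - w).N m k • mtPlus u.E m k + gapE dt dx u w m k)) := by
    have h := congrArg (Complex.I * ·) (schrodinger_gap dt dx u w m k)
    simp only [gapNE, mul_add, ← mul_assoc, Complex.I_mul_I, mul_smul_comm] at h ⊢
    linear_combination -h
  have hI : dxPlus dx (fun l => Complex.I * a l) k = Complex.I * dxPlus dx a k := by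
    simp only [dxPlus, mul_smul_comm, mul_sub]
  rw [dtPlus_norm_sq, massRate, greenDefect, hI, inner_I_mul_self, heq, inner_sub_left,
    inner_add_left, real_inner_smul_left, inner_I_mul_self, inner_I_mul_left (dxTwo dx a k),
    real_inner_comm (Complex.I * a k)]
  ring

theorem mass_step (hu : u.PeriodicAt K m) (hu' : u.PeriodicAt K (m + 1)) (hw : w.PeriodicAt K m)
    (hw' : w.PeriodicAt K (m + 1)) (hdx : 0 ≤ dx) (dt : ℝ) :
    dt⁻¹ * (mass dx K u w (m + 1) - mass dx K u w m) = meshSum dx K (massRate dt dx u w m) := by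
  have ha : Periodic (mtPlus (u - w).E m) (K : ℤ) :=
    periodic_mtPlus (hu.sub hw).E (hu'.sub hw').E
  rw [mass, mass, meshNorm_sq hdx, meshNorm_sq hdx,
    ← meshSum_dtPlus dt (fun j l => ‖(u - w).E j l‖ ^ 2),
    funext (dtPlus_mass_density dt dx u w m), meshSum_sub, meshSum_const_mul,
    meshSum_greenDefect (fun k => by rw [ha k]) ha]
  ring

end MeshTriple

section Conservation

open MeshTriple

variable {dt dx : ℝ} {M K : ℕ} {u : MeshTriple}

theorem IsDVDM.periodicAt (h : IsDVDM dt dx M K u.E u.N u.V) {m : ℕ} (hm : m ≤ M) :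
    u.PeriodicAt K m :=
  ⟨h.periodic_E m hm, h.periodic_N m hm, h.periodic_V m hm⟩

theorem IsDVDM.residualE_eq_zero (h : IsDVDM dt dx M K u.E u.N u.V) {m : ℕ} (hm : m < M) :
    residualE dt dx u m = 0 := by
  funext k
  rw [residualE, h.eq_E m hm, Complex.real_smul, Pi.zero_apply]
  ring

theorem IsDVDM.residualN_eq_zero (h : IsDVDM dt dx M K u.E u.N u.V) {m : ℕ} (hm : m < M) :
    residualN dt dx u m = 0 := by
  funext k
  rw [residualN, h.eq_N m hm, sub_self, Pi.zero_apply]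

theorem IsDVDM.residualV_eq_zero (h : IsDVDM dt dx M K u.E u.N u.V) {m : ℕ} (hm : m < M) :
    residualV dt u m = 0 := by
  funext k
  rw [residualV, h.eq_V m hm, Pi.zero_apply]
  ring

theorem isDVDM_zero (dt dx : ℝ) (M K : ℕ) :
    IsDVDM dt dx M K (0 : MeshTriple).E (0 : MeshTriple).N (0 : MeshTriple).V where
  periodic_E _ _ _ := rfl
  periodic_N _ _ _ := rfl
  periodic_V _ _ _ := rfl
  eq_E _ _ _ := by simp [dtPlus, dxTwo, mtPlus, zero_E, zero_N]
  eq_N _ _ _ := by simp [dtPlus, dxTwo, mtPlus, zero_N, zero_V]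
  eq_V _ _ _ := by simp [dtPlus, mtPlus, zero_E, zero_N, zero_V]

theorem IsDVDM.energyRate_zero_right (h : IsDVDM dt dx M K u.E u.N u.V) {m : ℕ} (hm : m < M)
    (k : ℤ) : energyRate dt dx u 0 m k = 0 := by
  have hz := isDVDM_zero dt dx M K
  simp [energyRate, gapE, gapN, gapV, h.residualE_eq_zero hm, h.residualN_eq_zero hm,
    h.residualV_eq_zero hm, hz.residualE_eq_zero hm, hz.residualN_eq_zero hm,
    hz.residualV_eq_zero hm, dxPlus, dtPlus, zero_E, zero_N]

theorem IsDVDM.massRate_zero_right (h : IsDVDM dt dx M K u.E u.N u.V) {m : ℕ} (hm : m < M)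
    (k : ℤ) : massRate dt dx u 0 m k = 0 := by
  rw [massRate, gapE, h.residualE_eq_zero hm, (isDVDM_zero dt dx M K).residualE_eq_zero hm,
    sub_self, Pi.zero_apply, add_zero, MeshTriple.sub_zero, mul_smul_comm, real_inner_smul_left,
    inner_I_mul_self, mul_zero, mul_zero]

theorem IsDVDM.energy_eq (h : IsDVDM dt dx M K u.E u.N u.V) (hdt : dt ≠ 0) {m : ℕ}
    (hm : m ≤ M) : energy dx K u 0 m = energy dx K u 0 0 := by
  induction m with
  | zero => rfl
  | succ m ih =>
    have hstep := energy_step (h.periodicAt (by lia)) (h.periodicAt hm) (periodicAt_zero K m)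
      (periodicAt_zero K (m + 1)) dt dx
    rw [funext (h.energyRate_zero_right hm), meshSum_const, mul_zero,
      mul_eq_zero_iff_left (inv_ne_zero hdt), sub_eq_zero] at hstep
    rw [hstep, ih (by lia)]

theorem IsDVDM.mass_eq (h : IsDVDM dt dx M K u.E u.N u.V) (hdt : dt ≠ 0) (hdx : 0 ≤ dx) {m : ℕ}
    (hm : m ≤ M) : mass dx K u 0 m = mass dx K u 0 0 := by
  induction m with
  | zero => rfl
  | succ m ih =>
    have hstep := mass_step (h.periodicAt (by lia)) (h.periodicAt hm) (periodicAt_zero K m)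
      (periodicAt_zero K (m + 1)) hdx dt
    rw [funext (h.massRate_zero_right hm), meshSum_const, mul_zero,
      mul_eq_zero_iff_left (inv_ne_zero hdt), sub_eq_zero] at hstep
    rw [hstep, ih (by lia)]

end Conservation

section AprioriBound

open MeshTriple

variable {dt dx : ℝ} {M K : ℕ}

theorem meshSum_norm_pow_four_le {F : Type*} [NormedAddCommGroup F] [NormedSpace ℝ F]
    (hdx : 0 < dx) (hK : 0 < K) {v : ℤ → F} (hv : Periodic v (K : ℤ)) :
    meshSum dx K (fun k => ‖v k‖ ^ 4)
      ≤ (K * dx)⁻¹ * (meshNorm dx K v ^ 2) ^ 2 + (meshNorm dx K v ^ 2) ^ 3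
        + meshNorm dx K (dxPlus dx v) ^ 2 := by
  set y := meshNorm dx K v
  set x := meshNorm dx K (dxPlus dx v)
  have hpoint : ∀ k, ‖v k‖ ^ 4 ≤ ((K * dx)⁻¹ * y ^ 2 + 2 * (y * x)) * ‖v k‖ ^ 2 := fun k => by
    have hgn := discrete_gagliardo_nirenberg hdx hK hv k
    calc ‖v k‖ ^ 4 = ‖v k‖ ^ 2 * ‖v k‖ ^ 2 := by ring
      _ ≤ ((K * dx)⁻¹ * y ^ 2 + 2 * (y * x)) * ‖v k‖ ^ 2 := by gcongr
  calc meshSum dx K (fun k => ‖v k‖ ^ 4)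
      ≤ meshSum dx K (fun k => ((K * dx)⁻¹ * y ^ 2 + 2 * (y * x)) * ‖v k‖ ^ 2) :=
        meshSum_mono hdx.le hpoint
    _ = (K * dx)⁻¹ * (y ^ 2) ^ 2 + 2 * y ^ 3 * x := by
        rw [meshSum_const_mul, ← meshNorm_sq hdx.le]; ring
    _ ≤ (K * dx)⁻¹ * (y ^ 2) ^ 2 + (y ^ 2) ^ 3 + x ^ 2 := by
        linarith [two_mul_le_add_sq (y ^ 3) x, show (y ^ 3) ^ 2 = (y ^ 2) ^ 3 by ring]

theorem dirichlet_le_energy (hdx : 0 < dx) (hK : 0 < K) {u : MeshTriple} {m : ℕ}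
    (hu : u.PeriodicAt K m) :
    meshNorm dx K (dxPlus dx (u.E m)) ^ 2 ≤ 2 * energy dx K u 0 m
      + ((K * dx)⁻¹ * mass dx K u 0 m ^ 2 + mass dx K u 0 m ^ 3) := by
  have hdensity : ∀ k, ‖dxPlus dx (u.E m) k‖ ^ 2
      ≤ energyDensity dx u 0 m k + 2⁻¹ * ‖u.E m k‖ ^ 4 := fun k => by
    simp only [energyDensity, gapSq, MeshTriple.sub_zero, zero_E, zero_N, Pi.zero_apply, norm_zero]
    nlinarith [sq_nonneg (u.N m k + ‖u.E m k‖ ^ 2), sq_nonneg (dxPlus dx (u.V m) k)]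
  have hsum := meshSum_mono (K := K) hdx.le hdensity
  rw [meshSum_add, meshSum_const_mul, ← meshNorm_sq hdx.le] at hsum
  have hquartic := meshSum_norm_pow_four_le hdx hK hu.E
  rw [mass, MeshTriple.sub_zero]
  change _ ≤ energy dx K u 0 m + _ at hsum
  linarith

/-- Bound for `|E|²` in terms of the period `L`, the mass `μ` and the energy `η`. -/
def supBound (L μ η : ℝ) : ℝ :=
  L⁻¹ * μ + μ + (2 * η + (L⁻¹ * μ ^ 2 + μ ^ 3))

theorem norm_E_sq_le_supBound (hdx : 0 < dx) (hK : 0 < K) {u : MeshTriple} {m : ℕ}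
    (hu : u.PeriodicAt K m) (j : ℤ) :
    ‖u.E m j‖ ^ 2 ≤ supBound (K * dx) (mass dx K u 0 m) (energy dx K u 0 m) := by
  have hgn := discrete_gagliardo_nirenberg hdx hK hu.E j
  have hdir := dirichlet_le_energy hdx hK hu
  have hamgm := two_mul_le_add_sq (meshNorm dx K (u.E m)) (meshNorm dx K (dxPlus dx (u.E m)))
  rw [supBound]
  rw [mass, MeshTriple.sub_zero] at *
  linarith

theorem IsDVDM.norm_E_sq_le {u : MeshTriple} (h : IsDVDM dt dx M K u.E u.N u.V) (hdt : dt ≠ 0)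
    (hdx : 0 < dx) (hK : 0 < K) {μ η : ℝ} (hμ : mass dx K u 0 0 ≤ μ) (hη : energy dx K u 0 0 ≤ η)
    {m : ℕ} (hm : m ≤ M) (j : ℤ) : ‖u.E m j‖ ^ 2 ≤ supBound (K * dx) μ η := by
  refine (norm_E_sq_le_supBound hdx hK (h.periodicAt hm) j).trans ?_
  have hmass : 0 ≤ mass dx K u 0 0 := sq_nonneg _
  rw [h.mass_eq hdt hdx.le hm, h.energy_eq hdt hm, supBound, supBound]
  gcongr

end AprioriBound

section Stability

namespace MeshTriple

variable {dt dx B R s : ℝ} {K M m : ℕ} {k : ℤ} {u w : MeshTriple}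

/-- At the time level `m` the triples `u`, `w` obey the uniform bound `B` that the stability
constants depend on. -/
structure BoundedAt (B : ℝ) (u w : MeshTriple) (m : ℕ) : Prop where
  E_left : ∀ k, ‖u.E m k‖ ≤ B
  E_right : ∀ k, ‖w.E m k‖ ≤ B
  N_right : ∀ k, ‖w.N m k‖ ≤ B

/-- In the time step from level `m` the reference `w` moves with speed at most `B`, and `u` and `w`
solve the scheme up to residuals which differ by at most `R`. -/
structure StepBound (dt dx B R : ℝ) (u w : MeshTriple) (m : ℕ) : Prop where
  dtPlus_E : ∀ k, ‖dtPlus dt w.E m k‖ ≤ B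
  dtPlus_N : ∀ k, ‖dtPlus dt w.N m k‖ ≤ B
  gapE : ∀ k, ‖gapE dt dx u w m k‖ ≤ R
  dxPlus_gapE : ∀ k, ‖dxPlus dx (MeshTriple.gapE dt dx u w m) k‖ ≤ R
  gapN : ∀ k, ‖gapN dt dx u w m k‖ ≤ R
  dxPlus_gapV : ∀ k, ‖dxPlus dx (gapV dt u w m) k‖ ≤ R

/-- The density of `errorFunctional` for the difference of two triples. -/
def errorDensity (dx : ℝ) (u w : MeshTriple) (m : ℕ) (k : ℤ) : ℝ :=
  ‖(u - w).E m k‖ ^ 2 + ‖dxPlus dx ((u - w).E m) k‖ ^ 2 + (u - w).N m k ^ 2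
    + dxPlus dx ((u - w).V m) k ^ 2

/-- The pointwise size of the errors whose squares make up `errorDensity` is at most `s`. -/
structure ErrorBoundedAt (dx s : ℝ) (u w : MeshTriple) (m : ℕ) (k : ℤ) : Prop where
  E : ‖(u - w).E m k‖ ≤ s
  dxPlus_E : ‖dxPlus dx ((u - w).E m) k‖ ≤ s
  N : ‖(u - w).N m k‖ ≤ s
  dxPlus_V : ‖dxPlus dx ((u - w).V m) k‖ ≤ s

theorem errorFunctional_eq (hdx : 0 ≤ dx) (u w : MeshTriple) (m : ℕ) :
    errorFunctional dx K ((u - w).E m) ((u - w).N m) ((u - w).V m)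
      = meshSum dx K (errorDensity dx u w m) := by
  simp only [errorFunctional, meshNorm_sq hdx, ← meshSum_add, Real.norm_eq_abs, sq_abs]
  rfl

theorem errorDensity_nonneg (dx : ℝ) (u w : MeshTriple) (m : ℕ) (k : ℤ) :
    0 ≤ errorDensity dx u w m k := by
  unfold errorDensity; positivity

theorem errorBoundedAt_of_errorDensity_le (hs : 0 ≤ s) (h : errorDensity dx u w m k ≤ s ^ 2) :
    ErrorBoundedAt dx s u w m k := by
  unfold errorDensity at h
  have hE := sq_nonneg ‖(u - w).E m k‖
  have hdE := sq_nonneg ‖dxPlus dx ((u - w).E m) k‖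
  have hN := sq_nonneg ((u - w).N m k)
  have hdV := sq_nonneg (dxPlus dx ((u - w).V m) k)
  exact ⟨le_of_sq_le_sq (by linarith) hs, le_of_sq_le_sq (by linarith) hs,
    abs_le_of_sq_le_sq (by linarith) hs, abs_le_of_sq_le_sq (by linarith) hs⟩

theorem BoundedAt.norm_gapSq_le (hB : BoundedAt B u w m) (k : ℤ) :
    ‖gapSq u w m k‖ ≤ 2 * B * ‖(u - w).E m k‖ := by
  rw [gapSq, sq_sub_sq, Real.norm_eq_abs, abs_mul, abs_of_nonneg (by positivity)]
  exact mul_le_mul (by linarith [hB.E_left k, hB.E_right k])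
    (abs_norm_sub_norm_le (u.E m k) (w.E m k)) (abs_nonneg _)
    (by linarith [norm_nonneg (u.E m k), hB.E_left k])

theorem norm_inner_I_mul_le {z y : ℂ} {b c : ℝ} (hz : ‖z‖ ≤ b) (hy : ‖y‖ ≤ c) :
    ‖inner ℝ (Complex.I * z) y‖ ≤ b * c := by
  refine (norm_inner_le_norm _ _).trans ?_
  rw [norm_mul, Complex.norm_I, one_mul]
  exact mul_le_mul hz hy (norm_nonneg _) ((norm_nonneg _).trans hz)

theorem BoundedAt.norm_smul_mtPlus_E_le (hB : BoundedAt B u w m) (hB' : BoundedAt B u w (m + 1))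
    (he : ErrorBoundedAt dx s u w m k) (he' : ErrorBoundedAt dx s u w (m + 1) k) :
    ‖mtPlus (u - w).N m k • mtPlus u.E m k‖ ≤ s * B := by
  rw [norm_smul]
  exact mul_le_mul (norm_mtPlus_le he.N he'.N) (norm_mtPlus_le (hB.E_left k) (hB'.E_left k))
    (norm_nonneg _) ((norm_nonneg _).trans he.N)

theorem BoundedAt.norm_gapNE_le (hB : BoundedAt B u w m) (hB' : BoundedAt B u w (m + 1))
    (he : ErrorBoundedAt dx s u w m k) (he' : ErrorBoundedAt dx s u w (m + 1) k) :
    ‖gapNE u w m k‖ ≤ 2 * B * s := by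
  have hN : ‖mtPlus w.N m k • mtPlus (u - w).E m k‖ ≤ B * s := by
    rw [norm_smul]
    exact mul_le_mul (norm_mtPlus_le (hB.N_right k) (hB'.N_right k)) (norm_mtPlus_le he.E he'.E)
      (norm_nonneg _) ((norm_nonneg _).trans (hB.N_right k))
  rw [gapNE]
  linarith [norm_add_le (mtPlus w.N m k • mtPlus (u - w).E m k)
    (mtPlus (u - w).N m k • mtPlus u.E m k), hB.norm_smul_mtPlus_E_le hB' he he']

theorem BoundedAt.norm_wave_forcing_le (hB : BoundedAt B u w m) (hB' : BoundedAt B u w (m + 1))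
    (he : ErrorBoundedAt dx s u w m k) (he' : ErrorBoundedAt dx s u w (m + 1) k) :
    ‖mtPlus (u - w).N m k + mtPlus (gapSq u w) m k‖ ≤ s + 2 * B * s := by
  have hB0 : 0 ≤ 2 * B := by linarith [norm_nonneg (u.E m k), hB.E_left k]
  exact (norm_add_le _ _).trans (add_le_add (norm_mtPlus_le he.N he'.N) (norm_mtPlus_le
    ((hB.norm_gapSq_le k).trans (mul_le_mul_of_nonneg_left he.E hB0))
    ((hB'.norm_gapSq_le k).trans (mul_le_mul_of_nonneg_left he'.E hB0))))

theorem massRate_le (hB1 : 1 ≤ B) (hRs : R ≤ s) (hB : BoundedAt B u w m)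
    (hB' : BoundedAt B u w (m + 1)) (hst : StepBound dt dx B R u w m)
    (he : ErrorBoundedAt dx s u w m k) (he' : ErrorBoundedAt dx s u w (m + 1) k) :
    massRate dt dx u w m k ≤ 4 * B * s ^ 2 := by
  have hforce : ‖mtPlus (u - w).N m k • mtPlus u.E m k + MeshTriple.gapE dt dx u w m k‖
      ≤ s * B + s :=
    (norm_add_le _ _).trans
      (add_le_add (hB.norm_smul_mtPlus_E_le hB' he he') ((hst.gapE k).trans hRs))
  have hinner := norm_inner_I_mul_le hforce (norm_mtPlus_le he.E he'.E)
  rw [massRate]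
  nlinarith [neg_le_of_abs_le hinner, mul_le_mul_of_nonneg_right hB1 (sq_nonneg s)]

theorem energyRate_le (hB1 : 1 ≤ B) (hRs : R ≤ s) (hB : BoundedAt B u w m)
    (hB' : BoundedAt B u w (m + 1)) (hst : StepBound dt dx B R u w m)
    (he : ErrorBoundedAt dx s u w m k) (he' : ErrorBoundedAt dx s u w (m + 1) k) :
    energyRate dt dx u w m k ≤ 13 * B * s ^ 2 := by
  have : 0 ≤ s := (norm_nonneg _).trans he.E
  have hB0 : 0 ≤ B := by linarith
  have ha : ‖mtPlus (u - w).E m k‖ ≤ s := norm_mtPlus_le he.E he'.E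
  have hdxa : ‖dxPlus dx (mtPlus (u - w).E m) k‖ ≤ s := by
    rw [dxPlus_mtPlus]; exact norm_mtPlus_le he.dxPlus_E he'.dxPlus_E
  have hdxv : ‖dxPlus dx (mtPlus (u - w).V m) k‖ ≤ s := by
    rw [dxPlus_mtPlus]; exact norm_mtPlus_le he.dxPlus_V he'.dxPlus_V
  have hsq : ‖mtPlus (fun j l => ‖(u - w).E j l‖ ^ 2) m k‖ ≤ s ^ 2 :=
    norm_mtPlus_le (by simpa using pow_le_pow_left₀ (norm_nonneg _) he.E 2)
      (by simpa using pow_le_pow_left₀ (norm_nonneg _) he'.E 2)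
  have hdxE := norm_inner_I_mul_le ((hst.dxPlus_gapE k).trans hRs) hdxa
  have hNE := norm_inner_I_mul_le ((hst.gapE k).trans hRs) (hB.norm_gapNE_le hB' he he')
  have hwave := norm_mul_le_of_le ((hst.gapN k).trans hRs) (hB.norm_wave_forcing_le hB' he he')
  have hV := norm_mul_le_of_le ((hst.dxPlus_gapV k).trans hRs) hdxv
  have hwE := norm_mul_le_of_le (norm_mtPlus_le he.N he'.N) ((norm_inner_le_norm _ _).trans
    (mul_le_mul (hst.dtPlus_E k) ha (norm_nonneg _) hB0))
  have hwN := norm_mul_le_of_le (hst.dtPlus_N k) hsq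
  have hBs : s ^ 2 ≤ B * s ^ 2 := le_mul_of_one_le_left (sq_nonneg s) hB1
  rw [energyRate, mul_assoc 2]
  linarith [neg_le_of_abs_le hdxE, neg_le_of_abs_le hNE, le_of_abs_le hwave, le_of_abs_le hV,
    le_of_abs_le hwE, le_of_abs_le hwN]

/-- The relative energy plus the multiple of the relative mass that makes it coercive. -/
def lyapunov (dx : ℝ) (K : ℕ) (B : ℝ) (u w : MeshTriple) (m : ℕ) : ℝ :=
  energy dx K u w m + 6 * B ^ 2 * mass dx K u w m

theorem lyapunov_eq (hdx : 0 ≤ dx) (B : ℝ) (u w : MeshTriple) (m : ℕ) :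
    lyapunov dx K B u w m
      = meshSum dx K (fun k => energyDensity dx u w m k + 6 * B ^ 2 * ‖(u - w).E m k‖ ^ 2) := by
  rw [lyapunov, energy, mass, meshNorm_sq hdx, meshSum_add, meshSum_const_mul]

theorem errorDensity_le (hB1 : 1 ≤ B) (hB : BoundedAt B u w m) (k : ℤ) :
    errorDensity dx u w m k
      ≤ 4 * (energyDensity dx u w m k + 6 * B ^ 2 * ‖(u - w).E m k‖ ^ 2) := by
  have hq : -((u - w).N m k * gapSq u w m k)
      ≤ (u - w).N m k ^ 2 / 4 + 4 * B ^ 2 * ‖(u - w).E m k‖ ^ 2 := by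
    have hprod := norm_mul_le_of_le (le_refl ‖(u - w).N m k‖) (hB.norm_gapSq_le k)
    have hsq : ‖(u - w).N m k‖ ^ 2 = (u - w).N m k ^ 2 := sq_abs _
    linarith [neg_le_of_abs_le hprod,
      sq_nonneg (‖(u - w).N m k‖ / 2 - 2 * B * ‖(u - w).E m k‖)]
  have hN : -(w.N m k * ‖(u - w).E m k‖ ^ 2) ≤ B ^ 2 * ‖(u - w).E m k‖ ^ 2 := by
    rw [← neg_mul]
    exact mul_le_mul_of_nonneg_right (by nlinarith [neg_le_of_abs_le (hB.N_right k)])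
      (sq_nonneg _)
  have ha : ‖(u - w).E m k‖ ^ 2 ≤ B ^ 2 * ‖(u - w).E m k‖ ^ 2 :=
    le_mul_of_one_le_left (sq_nonneg _) (one_le_pow₀ hB1)
  rw [errorDensity, energyDensity]
  linarith [sq_nonneg ‖(u - w).E m k‖, sq_nonneg ‖dxPlus dx ((u - w).E m) k‖,
    sq_nonneg (dxPlus dx ((u - w).V m) k)]

theorem meshSum_errorDensity_le (hdx : 0 ≤ dx) (hB1 : 1 ≤ B) (hB : BoundedAt B u w m) :
    meshSum dx K (errorDensity dx u w m) ≤ 4 * lyapunov dx K B u w m := by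
  rw [lyapunov_eq hdx, ← meshSum_const_mul]
  exact meshSum_mono hdx (errorDensity_le hB1 hB)

theorem lyapunovRate_le (hB1 : 1 ≤ B) (hB : BoundedAt B u w m)
    (hB' : BoundedAt B u w (m + 1)) (hst : StepBound dt dx B R u w m) (k : ℤ) :
    energyRate dt dx u w m k + 6 * B ^ 2 * massRate dt dx u w m k
      ≤ 37 * B ^ 3 * (errorDensity dx u w (m + 1) k + errorDensity dx u w m k + R ^ 2) := by
  have hD := errorDensity_nonneg dx u w m k
  have hD' := errorDensity_nonneg dx u w (m + 1) k
  set Q := errorDensity dx u w (m + 1) k + errorDensity dx u w m k + R ^ 2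
  have hsqrt : √Q ^ 2 = Q := Real.sq_sqrt (by positivity)
  have hRs : R ≤ √Q := Real.le_sqrt_of_sq_le (by linarith)
  have he : ErrorBoundedAt dx √Q u w m k :=
    errorBoundedAt_of_errorDensity_le (Real.sqrt_nonneg _) (by linarith [sq_nonneg R])
  have he' : ErrorBoundedAt dx √Q u w (m + 1) k :=
    errorBoundedAt_of_errorDensity_le (Real.sqrt_nonneg _) (by linarith [sq_nonneg R])
  have henergy := energyRate_le hB1 hRs hB hB' hst he he'
  have hmass := massRate_le hB1 hRs hB hB' hst he he'
  rw [hsqrt] at henergy hmass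
  have hB3 : B ≤ B ^ 3 := le_self_pow₀ hB1 three_ne_zero
  calc energyRate dt dx u w m k + 6 * B ^ 2 * massRate dt dx u w m k
      ≤ 13 * B * Q + 6 * B ^ 2 * (4 * B * Q) := by gcongr
    _ ≤ 13 * B ^ 3 * Q + 6 * B ^ 2 * (4 * B * Q) := by gcongr
    _ = 37 * B ^ 3 * Q := by ring

theorem lyapunov_step (hdt : 0 < dt) (hdx : 0 ≤ dx) (hB1 : 1 ≤ B)
    (hu : u.PeriodicAt K m) (hu' : u.PeriodicAt K (m + 1)) (hw : w.PeriodicAt K m)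
    (hw' : w.PeriodicAt K (m + 1)) (hB : BoundedAt B u w m) (hB' : BoundedAt B u w (m + 1))
    (hst : StepBound dt dx B R u w m) :
    lyapunov dx K B u w (m + 1) - lyapunov dx K B u w m
      ≤ 148 * B ^ 3 * dt
        * (lyapunov dx K B u w (m + 1) + lyapunov dx K B u w m + K * dx * R ^ 2) := by
  have hrate : dt⁻¹ * (lyapunov dx K B u w (m + 1) - lyapunov dx K B u w m)
      = meshSum dx K
        (fun k => energyRate dt dx u w m k + 6 * B ^ 2 * massRate dt dx u w m k) := by
    rw [meshSum_add, meshSum_const_mul, ← energy_step hu hu' hw hw' dt dx,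
      ← mass_step hu hu' hw hw' hdx dt, lyapunov, lyapunov]
    ring
  have hsum := meshSum_mono (K := K) hdx (lyapunovRate_le hB1 hB hB' hst)
  rw [← hrate, meshSum_const_mul, meshSum_add, meshSum_add, meshSum_const,
    inv_mul_le_iff₀ hdt] at hsum
  have hc := meshSum_errorDensity_le (K := K) hdx hB1 hB
  have hc' := meshSum_errorDensity_le (K := K) hdx hB1 hB'
  refine hsum.trans ?_
  calc dt * (37 * B ^ 3 * (meshSum dx K (errorDensity dx u w (m + 1))
        + meshSum dx K (errorDensity dx u w m) + K * dx * R ^ 2))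
      ≤ dt * (37 * B ^ 3 * (4 * lyapunov dx K B u w (m + 1) + 4 * lyapunov dx K B u w m
        + 4 * (K * dx * R ^ 2))) := by
        refine mul_le_mul_of_nonneg_left (mul_le_mul_of_nonneg_left ?_ (by positivity)) hdt.le
        linarith [show 0 ≤ K * dx * R ^ 2 by positivity]
    _ = _ := by ring

theorem lyapunov_nonneg (hdx : 0 ≤ dx) (hB1 : 1 ≤ B) (hB : BoundedAt B u w m) :
    0 ≤ lyapunov dx K B u w m := by
  linarith [meshSum_errorDensity_le (K := K) hdx hB1 hB,
    meshSum_nonneg (K := K) hdx (errorDensity_nonneg dx u w m)]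

end MeshTriple

theorem discrete_gronwall {Φ : ℕ → ℝ} {M : ℕ} {θ ρ : ℝ} (hθ : 0 ≤ θ) (hθ' : θ ≤ 1 / 2)
    (hρ : 0 ≤ ρ) (hΦ : ∀ m ≤ M, 0 ≤ Φ m)
    (hstep : ∀ m < M, Φ (m + 1) - Φ m ≤ θ * (Φ (m + 1) + Φ m + ρ)) {m : ℕ} (hm : m ≤ M) :
    Φ m + ρ ≤ Real.exp (4 * θ * m) * (Φ 0 + ρ) := by
  induction m with
  | zero => simp
  | succ m ih =>
    have hgrowth : Φ (m + 1) + ρ ≤ (1 + 4 * θ) * (Φ m + ρ) := by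
      have himplicit : (1 - θ) * (Φ (m + 1) + ρ) ≤ (1 + θ) * (Φ m + ρ) := by
        linarith [hstep m hm, mul_nonneg hθ hρ]
      have hfactor : 1 + θ ≤ (1 - θ) * (1 + 4 * θ) := by nlinarith
      refine le_of_mul_le_mul_left (himplicit.trans ?_) (show 0 < 1 - θ by linarith)
      rw [← mul_assoc]
      exact mul_le_mul_of_nonneg_right hfactor (add_nonneg (hΦ m (by lia)) hρ)
    calc Φ (m + 1) + ρ ≤ (1 + 4 * θ) * (Φ m + ρ) := hgrowth
      _ ≤ Real.exp (4 * θ) * (Real.exp (4 * θ * m) * (Φ 0 + ρ)) := by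
        gcongr
        · exact add_nonneg (hΦ m (by lia)) hρ
        · linarith [Real.add_one_le_exp (4 * θ)]
        · exact ih (by lia)
      _ = Real.exp (4 * θ * (m + 1 : ℕ)) * (Φ 0 + ρ) := by
        rw [← mul_assoc, ← Real.exp_add]; push_cast; ring_nf

open MeshTriple in
theorem stability {dt dx B R : ℝ} {K M : ℕ} {u w : MeshTriple} (hdt : 0 < dt) (hdx : 0 ≤ dx)
    (hB1 : 1 ≤ B) (hu : ∀ m ≤ M, u.PeriodicAt K m) (hw : ∀ m ≤ M, w.PeriodicAt K m)
    (hB : ∀ m ≤ M, BoundedAt B u w m) (hst : ∀ m < M, StepBound dt dx B R u w m)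
    (hsmall : 148 * B ^ 3 * dt ≤ 1 / 2) {m : ℕ} (hm : m ≤ M) :
    errorFunctional dx K ((u - w).E m) ((u - w).N m) ((u - w).V m)
      ≤ 4 * (Real.exp (4 * (148 * B ^ 3 * dt) * m)
        * (lyapunov dx K B u w 0 + K * dx * R ^ 2)) := by
  have hρ : 0 ≤ K * dx * R ^ 2 := by positivity
  have hgronwall := discrete_gronwall (by positivity) hsmall hρ
    (fun j hj => lyapunov_nonneg hdx hB1 (hB j hj))
    (fun j hj => lyapunov_step hdt hdx hB1 (hu j hj.le) (hu (j + 1) hj) (hw j hj.le)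
      (hw (j + 1) hj) (hB j hj.le) (hB (j + 1) hj) (hst j hj)) hm
  rw [errorFunctional_eq hdx]
  linarith [meshSum_errorDensity_le (K := K) hdx hB1 (hB m hm)]

theorem MeshTriple.lyapunov_of_E_N_eq {dx B : ℝ} {K m : ℕ} {u w : MeshTriple} (hdx : 0 ≤ dx)
    (hE : u.E m = w.E m) (hN : u.N m = w.N m) :
    lyapunov dx K B u w m = meshNorm dx K (dxPlus dx ((u - w).V m)) ^ 2 / 2 := by
  have ha : (u - w).E m = 0 := by rw [sub_E, Pi.sub_apply, hE, sub_self]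
  have hn : (u - w).N m = 0 := by rw [sub_N, Pi.sub_apply, hN, sub_self]
  rw [lyapunov_eq hdx, meshNorm_sq hdx, div_eq_inv_mul, ← meshSum_const_mul]
  congr 1
  funext k
  have hzero : dxPlus dx (0 : ℤ → ℂ) k = 0 := by
    simp only [dxPlus, Pi.zero_apply, sub_self, smul_zero]
  simp only [energyDensity, ha, hzero, hn, Pi.zero_apply, norm_zero, Real.norm_eq_abs, sq_abs]
  ring

end Stability

section Taylor

variable {F : Type*} [NormedAddCommGroup F] [NormedSpace ℝ F]

/-- `g` has the derivative `g'` on `S`, one-sided at the end points of an interval. -/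
def HasDerivOn (g g' : ℝ → F) (S : Set ℝ) : Prop :=
  ∀ s ∈ S, HasDerivWithinAt g (g' s) S s

variable {g g₁ g₂ g₃ g₄ : ℝ → F} {a b c r s t : ℝ} {n : ℕ} {S S' : Set ℝ}

theorem HasDerivOn.mono (hg : HasDerivOn g g₁ S) (hS : S' ⊆ S) : HasDerivOn g g₁ S' :=
  fun s hs => (hg s (hS hs)).mono hS

theorem HasDerivOn.comp_const_add (hg : HasDerivOn g g₁ (Set.Icc (t - r) (t + r))) :
    HasDerivOn (fun s => g (t + s)) (fun s => g₁ (t + s)) (Set.Icc 0 r) := fun s hs => by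
  have hmaps : Set.MapsTo (fun s => t + s) (Set.Icc 0 r) (Set.Icc (t - r) (t + r)) :=
    fun y hy => by constructor <;> linarith [hy.1, hy.2]
  simpa only [comp_def, one_smul] using
    (hg (t + s) (hmaps hs)).scomp s ((hasDerivAt_id s).const_add t).hasDerivWithinAt hmaps

theorem HasDerivOn.comp_const_sub (hg : HasDerivOn g g₁ (Set.Icc (t - r) (t + r))) :
    HasDerivOn (fun s => g (t - s)) (fun s => -g₁ (t - s)) (Set.Icc 0 r) := fun s hs => by
  have hmaps : Set.MapsTo (fun s => t - s) (Set.Icc 0 r) (Set.Icc (t - r) (t + r)) :=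
    fun y hy => by constructor <;> linarith [hy.1, hy.2]
  simpa only [comp_def, neg_one_smul] using
    (hg (t - s) (hmaps hs)).scomp s ((hasDerivAt_id s).const_sub t).hasDerivWithinAt hmaps

theorem HasDerivOn.norm_sub_le (hg : HasDerivOn g g₁ (Set.Icc a b)) (hab : a ≤ b)
    (hc : ∀ s ∈ Set.Icc a b, ‖g₁ s‖ ≤ c) : ‖g b - g a‖ ≤ c * (b - a) := by
  have hmvt := (convex_Icc a b).norm_image_sub_le_of_norm_hasDerivWithin_le hg hc
    (Set.left_mem_Icc.2 hab) (Set.right_mem_Icc.2 hab)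
  rwa [Real.norm_of_nonneg (sub_nonneg.2 hab)] at hmvt

theorem HasDerivOn.norm_le_mul_pow (hg : HasDerivOn g g₁ (Set.Icc 0 r)) (h0 : g 0 = 0)
    (hc0 : 0 ≤ c) (hc : ∀ s ∈ Set.Icc 0 r, ‖g₁ s‖ ≤ c * s ^ n) (hs : s ∈ Set.Icc 0 r) :
    ‖g s‖ ≤ c * s ^ (n + 1) := by
  have hsub : Set.Icc 0 s ⊆ Set.Icc 0 r := Set.Icc_subset_Icc_right hs.2
  have hmvt := (hg.mono hsub).norm_sub_le hs.1 fun y hy => (hc y (hsub hy)).trans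
    (mul_le_mul_of_nonneg_left (pow_le_pow_left₀ hy.1 hy.2 n) hc0)
  rwa [h0, sub_zero, sub_zero, mul_assoc, ← pow_succ] at hmvt

theorem HasDerivOn.norm_symm_sub_le (hg : HasDerivOn g g₁ (Set.Icc (t - r) (t + r)))
    (hc : ∀ s ∈ Set.Icc (t - r) (t + r), ‖g₁ s‖ ≤ c) (hs : s ∈ Set.Icc 0 r) :
    ‖g (t + s) - g (t - s)‖ ≤ 2 * c * s := by
  have hsub : Set.Icc (t - s) (t + s) ⊆ Set.Icc (t - r) (t + r) :=
    Set.Icc_subset_Icc (by linarith [hs.2]) (by linarith [hs.2])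
  have hmvt := (hg.mono hsub).norm_sub_le (by linarith [hs.1]) fun y hy => hc y (hsub hy)
  linarith

theorem HasDerivOn.norm_symm_add_le (hg : HasDerivOn g g₁ (Set.Icc (t - r) (t + r)))
    (hg₁ : HasDerivOn g₁ g₂ (Set.Icc (t - r) (t + r))) (hc0 : 0 ≤ c)
    (hc : ∀ s ∈ Set.Icc (t - r) (t + r), ‖g₂ s‖ ≤ c) (hs : s ∈ Set.Icc 0 r) :
    ‖g (t + s) + g (t - s) - (2 : ℝ) • g t‖ ≤ 2 * c * s ^ 2 := by
  have hderiv : HasDerivOn (fun s => g (t + s) + g (t - s) - (2 : ℝ) • g t)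
      (fun s => g₁ (t + s) - g₁ (t - s)) (Set.Icc 0 r) := fun s hs =>
    (((hg.comp_const_add s hs).add (hg.comp_const_sub s hs)).sub_const _).congr_deriv
      (sub_eq_add_neg _ _).symm
  refine hderiv.norm_le_mul_pow ?_ (by positivity) (fun s hs => ?_) hs
  · rw [add_zero, sub_zero]; module
  · rw [pow_one]; exact hg₁.norm_symm_sub_le hc hs

theorem HasDerivOn.norm_symm_sub_sub_le (hg : HasDerivOn g g₁ (Set.Icc (t - r) (t + r)))
    (hg₁ : HasDerivOn g₁ g₂ (Set.Icc (t - r) (t + r)))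
    (hg₂ : HasDerivOn g₂ g₃ (Set.Icc (t - r) (t + r))) (hc0 : 0 ≤ c)
    (hc : ∀ s ∈ Set.Icc (t - r) (t + r), ‖g₃ s‖ ≤ c) (hs : s ∈ Set.Icc 0 r) :
    ‖g (t + s) - g (t - s) - (2 * s) • g₁ t‖ ≤ 2 * c * s ^ 3 := by
  have hlin : ∀ s, HasDerivWithinAt (fun s : ℝ => (2 * s) • g₁ t) ((2 : ℝ) • g₁ t)
      (Set.Icc 0 r) s := fun s => by
    simpa using (((hasDerivAt_id s).const_mul (2 : ℝ)).smul_const (g₁ t)).hasDerivWithinAt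
  have hderiv : HasDerivOn (fun s => g (t + s) - g (t - s) - (2 * s) • g₁ t)
      (fun s => g₁ (t + s) + g₁ (t - s) - (2 : ℝ) • g₁ t) (Set.Icc 0 r) := fun s hs =>
    (((hg.comp_const_add s hs).sub (hg.comp_const_sub s hs)).sub (hlin s)).congr_deriv (by module)
  refine hderiv.norm_le_mul_pow ?_ (by positivity)
    (fun s hs => hg₁.norm_symm_add_le hg₂ hc0 hc hs) hs
  rw [add_zero, sub_zero]; module

theorem HasDerivOn.norm_symm_add_sub_le (hg : HasDerivOn g g₁ (Set.Icc (t - r) (t + r)))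
    (hg₁ : HasDerivOn g₁ g₂ (Set.Icc (t - r) (t + r)))
    (hg₂ : HasDerivOn g₂ g₃ (Set.Icc (t - r) (t + r)))
    (hg₃ : HasDerivOn g₃ g₄ (Set.Icc (t - r) (t + r))) (hc0 : 0 ≤ c)
    (hc : ∀ s ∈ Set.Icc (t - r) (t + r), ‖g₄ s‖ ≤ c) (hs : s ∈ Set.Icc 0 r) :
    ‖g (t + s) + g (t - s) - (2 : ℝ) • g t - s ^ 2 • g₂ t‖ ≤ 2 * c * s ^ 4 := by
  have hquad : ∀ s, HasDerivWithinAt (fun s : ℝ => s ^ 2 • g₂ t) ((2 * s) • g₂ t)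
      (Set.Icc 0 r) s := fun s => by
    simpa using (((hasDerivAt_id s).pow 2).smul_const (g₂ t)).hasDerivWithinAt
  have hderiv : HasDerivOn (fun s => g (t + s) + g (t - s) - (2 : ℝ) • g t - s ^ 2 • g₂ t)
      (fun s => g₁ (t + s) - g₁ (t - s) - (2 * s) • g₂ t) (Set.Icc 0 r) := fun s hs =>
    ((((hg.comp_const_add s hs).add (hg.comp_const_sub s hs)).sub_const _).sub
      (hquad s)).congr_deriv (by module)
  refine hderiv.norm_le_mul_pow ?_ (by positivity)
    (fun s hs => hg₁.norm_symm_sub_sub_le hg₂ hg₃ hc0 hc hs) hs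
  rw [add_zero, sub_zero]; module

/-- The map `ℝ → F` carries the product topology: `ℓ` is a combination of point values. -/
theorem HasDerivOn.clm_apply {G : Type*} [NormedAddCommGroup G] [NormedSpace ℝ G]
    {f f' : ℝ → ℝ → F} (hf : ∀ x, HasDerivOn (fun s => f s x) (fun s => f' s x) S)
    (ℓ : (ℝ → F) →L[ℝ] G) : HasDerivOn (fun s => ℓ (f s)) (fun s => ℓ (f' s)) S := fun s hs => by
  have hslope : slope (fun y => ℓ (f y)) s = fun y => ℓ (slope f s y) := by
    funext y; simp only [slope_def_module, map_smul, map_sub]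
  rw [hasDerivWithinAt_iff_tendsto_slope, hslope]
  exact (ℓ.continuous.tendsto _).comp (tendsto_pi_nhds.2 fun x =>
    hasDerivWithinAt_iff_tendsto_slope.1 (hf x s hs))

end Taylor

section Smooth

variable {F : Type*} [NormedAddCommGroup F] [NormedSpace ℝ F] {T L : ℝ} {n : ℕ} {f : ℝ → ℝ → F}

/-- The partial derivative `f_t` on `[0, T] × ℝ`, one-sided at the end points. -/
def dT (T : ℝ) (f : ℝ → ℝ → F) (t x : ℝ) : F :=
  derivWithin (fun s => f s x) (Set.Icc 0 T) t

/-- The partial derivative `f_x`. -/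
def dX (f : ℝ → ℝ → F) (t x : ℝ) : F :=
  deriv (f t) x

theorem SmoothOnStrip.of_le {m : ℕ} (hf : SmoothOnStrip n T f) (hmn : m ≤ n) :
    SmoothOnStrip m T f :=
  ContDiffOn.of_le hf (by exact_mod_cast hmn)

theorem SmoothOnStrip.hasFDerivWithinAt (hf : SmoothOnStrip (n + 1) T f) {t : ℝ}
    (ht : t ∈ Set.Icc 0 T) (x : ℝ) :
    HasFDerivWithinAt (fun p : ℝ × ℝ => f p.1 p.2)
      (fderivWithin ℝ (fun p : ℝ × ℝ => f p.1 p.2) (Set.Icc 0 T ×ˢ Set.univ) (t, x))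
      (Set.Icc 0 T ×ˢ Set.univ) (t, x) :=
  (ContDiffOn.differentiableOn hf (by simp) (t, x) ⟨ht, Set.mem_univ x⟩).hasFDerivWithinAt

theorem SmoothOnStrip.hasDerivWithinAt_fderivWithin (hf : SmoothOnStrip (n + 1) T f) {t : ℝ}
    (ht : t ∈ Set.Icc 0 T) (x : ℝ) :
    HasDerivWithinAt (fun s => f s x)
      (fderivWithin ℝ (fun p : ℝ × ℝ => f p.1 p.2) (Set.Icc 0 T ×ˢ Set.univ) (t, x) (1, 0))
      (Set.Icc 0 T) t :=
  (hf.hasFDerivWithinAt ht x).comp_hasDerivWithinAt (f := fun s => (s, x)) t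
    ((hasDerivWithinAt_id t _).prodMk (hasDerivWithinAt_const t _ x))
    fun _ hs => ⟨hs, Set.mem_univ x⟩

theorem SmoothOnStrip.hasDerivAt_fderivWithin (hf : SmoothOnStrip (n + 1) T f) {t : ℝ}
    (ht : t ∈ Set.Icc 0 T) (x : ℝ) :
    HasDerivAt (f t)
      (fderivWithin ℝ (fun p : ℝ × ℝ => f p.1 p.2) (Set.Icc 0 T ×ˢ Set.univ) (t, x) (0, 1)) x := by
  rw [← hasDerivWithinAt_univ]
  exact (hf.hasFDerivWithinAt ht x).comp_hasDerivWithinAt (f := fun y => (t, y)) x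
    ((hasDerivWithinAt_const x _ t).prodMk (hasDerivWithinAt_id x _)) fun _ hy => ⟨ht, hy⟩

theorem SmoothOnStrip.hasDerivOn_dT (hf : SmoothOnStrip (n + 1) T f) (x : ℝ) :
    HasDerivOn (fun s => f s x) (fun s => dT T f s x) (Set.Icc 0 T) := fun _ ht =>
  (hf.hasDerivWithinAt_fderivWithin ht x).differentiableWithinAt.hasDerivWithinAt

theorem SmoothOnStrip.hasDerivAt_dX (hf : SmoothOnStrip (n + 1) T f) {t : ℝ}
    (ht : t ∈ Set.Icc 0 T) (x : ℝ) : HasDerivAt (f t) (dX f t x) x :=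
  (hf.hasDerivAt_fderivWithin ht x).differentiableAt.hasDerivAt

theorem SmoothOnStrip.contDiffOn_fderivWithin (hT : 0 < T) (hf : SmoothOnStrip (n + 1) T f)
    (y : ℝ × ℝ) :
    ContDiffOn ℝ n (fun q => fderivWithin ℝ (fun p : ℝ × ℝ => f p.1 p.2)
      (Set.Icc 0 T ×ˢ Set.univ) q y) (Set.Icc 0 T ×ˢ Set.univ) :=
  (ContDiffOn.fderivWithin hf ((uniqueDiffOn_Icc hT).prod uniqueDiffOn_univ)
    (by norm_cast)).clm_apply contDiffOn_const

theorem SmoothOnStrip.dT (hf : SmoothOnStrip (n + 1) T f) (hT : 0 < T) :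
    SmoothOnStrip n T (dT T f) :=
  (hf.contDiffOn_fderivWithin hT (1, 0)).congr fun p hp =>
    (hf.hasDerivWithinAt_fderivWithin hp.1 p.2).derivWithin (uniqueDiffOn_Icc hT p.1 hp.1)

theorem SmoothOnStrip.dX (hf : SmoothOnStrip (n + 1) T f) (hT : 0 < T) :
    SmoothOnStrip n T (dX f) :=
  (hf.contDiffOn_fderivWithin hT (0, 1)).congr fun p hp =>
    (hf.hasDerivAt_fderivWithin hp.1 p.2).deriv

/-- `f` is of class `C^n` on `[0, T] × ℝ` and `L`-periodic in `x`. -/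
structure SmoothPeriodic (n : ℕ) (T L : ℝ) (f : ℝ → ℝ → F) : Prop where
  smooth : SmoothOnStrip n T f
  periodic : ∀ t ∈ Set.Icc 0 T, Periodic (f t) L

theorem SmoothPeriodic.of_le {m : ℕ} (hf : SmoothPeriodic n T L f) (hmn : m ≤ n) :
    SmoothPeriodic m T L f :=
  ⟨hf.smooth.of_le hmn, hf.periodic⟩

theorem SmoothPeriodic.dT (hf : SmoothPeriodic (n + 1) T L f) (hT : 0 < T) :
    SmoothPeriodic n T L (dT T f) :=
  ⟨hf.smooth.dT hT, fun t ht x =>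
    derivWithin_congr (fun s hs => hf.periodic s hs x) (hf.periodic t ht x)⟩

theorem SmoothPeriodic.dX (hf : SmoothPeriodic (n + 1) T L f) (hT : 0 < T) :
    SmoothPeriodic n T L (dX f) :=
  ⟨hf.smooth.dX hT, fun t ht x => by
    rw [Zakharov.dX, Zakharov.dX, ← deriv_comp_add_const, funext (hf.periodic t ht)]⟩

theorem SmoothPeriodic.norm_sq {f : ℝ → ℝ → ℂ} (hf : SmoothPeriodic n T L f) :
    SmoothPeriodic n T L (fun t x => ‖f t x‖ ^ 2) :=
  ⟨ContDiffOn.norm_sq ℝ hf.smooth, fun t ht x => by simp only [hf.periodic t ht x]⟩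

theorem SmoothPeriodic.exists_norm_le (hf : SmoothPeriodic n T L f) (hL : 0 < L) :
    ∃ c, ∀ t ∈ Set.Icc 0 T, ∀ x, ‖f t x‖ ≤ c := by
  obtain ⟨c, hc⟩ := (isCompact_Icc.prod isCompact_Icc :
    IsCompact (Set.Icc 0 T ×ˢ Set.Icc 0 L)).exists_bound_of_continuousOn
    ((ContDiffOn.continuousOn hf.smooth).mono (Set.prod_mono le_rfl (Set.subset_univ _)))
  refine ⟨c, fun t ht x => ?_⟩
  obtain ⟨y, hy, hxy⟩ := (hf.periodic t ht).exists_mem_Ico₀ hL x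
  rw [hxy]
  exact hc (t, y) ⟨ht, Set.Ico_subset_Icc_self hy⟩

end Smooth

section LipBound

variable {F : Type*} [NormedAddCommGroup F] [NormedSpace ℝ F] {c c' d h t x : ℝ}

/-- Evaluation at `x`, continuous for the topology of pointwise convergence. -/
def pointEval (x : ℝ) : (ℝ → F) →L[ℝ] F :=
  ContinuousLinearMap.proj (R := ℝ) (φ := fun _ : ℝ => F) x

/-- The value of a function at `x` and its difference quotient with increment `d` there, as a
continuous linear map for the topology of pointwise convergence. -/
def jet (d x : ℝ) : (ℝ → F) →L[ℝ] F × F :=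
  (pointEval x).prod (d⁻¹ • (pointEval (x + d) - pointEval x))

/-- `c` is a bound on `G` and a Lipschitz constant of `G`, that is, a bound in `W^{1,∞}`. -/
def LipBound (c : ℝ) (G : ℝ → F) : Prop :=
  ∀ d x, ‖jet d x G‖ ≤ c

theorem jet_apply (d x : ℝ) (G : ℝ → F) : jet d x G = (G x, d⁻¹ • (G (x + d) - G x)) := rfl

theorem lipBound_iff {G : ℝ → F} :
    LipBound c G ↔ ∀ d x, ‖G x‖ ≤ c ∧ ‖d⁻¹ • (G (x + d) - G x)‖ ≤ c := by
  simp only [LipBound, jet_apply, Prod.norm_mk, max_le_iff]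

variable {G H : ℝ → F}

theorem LipBound.norm_le (hG : LipBound c G) (x : ℝ) : ‖G x‖ ≤ c :=
  (lipBound_iff.1 hG 0 x).1

theorem LipBound.nonneg (hG : LipBound c G) : 0 ≤ c :=
  (norm_nonneg _).trans (hG 0 0)

theorem LipBound.mono (hG : LipBound c G) (hcc : c ≤ c') : LipBound c' G :=
  fun d x => (hG d x).trans hcc

theorem LipBound.add (hG : LipBound c G) (hH : LipBound c' H) : LipBound (c + c') (G + H) :=
  fun d x => by rw [map_add]; exact norm_add_le_of_le (hG d x) (hH d x)

theorem LipBound.sub (hG : LipBound c G) (hH : LipBound c' H) : LipBound (c + c') (G - H) :=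
  fun d x => by rw [map_sub]; exact norm_sub_le_of_le (hG d x) (hH d x)

theorem LipBound.I_smul {G : ℝ → ℂ} (hG : LipBound c G) : LipBound c (Complex.I • G) :=
  lipBound_iff.2 fun d x => by
    simpa only [Pi.smul_apply, ← smul_sub, smul_comm d⁻¹ Complex.I, norm_smul, Complex.norm_I,
      one_mul] using lipBound_iff.1 hG d x

theorem LipBound.smul {φ : ℝ → ℝ} (hφ : LipBound c φ) (hG : LipBound c' G) :
    LipBound (2 * (c * c')) (φ • G) := lipBound_iff.2 fun d x => by
  have hprod : ∀ {a : ℝ} {v : F}, ‖a‖ ≤ c → ‖v‖ ≤ c' → ‖a • v‖ ≤ c * c' := fun ha hv =>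
    (norm_smul_le _ _).trans (mul_le_mul ha hv (norm_nonneg _) hφ.nonneg)
  have hleibniz : d⁻¹ • ((φ • G) (x + d) - (φ • G) x)
      = φ (x + d) • (d⁻¹ • (G (x + d) - G x)) + (d⁻¹ • (φ (x + d) - φ x)) • G x := by
    simp only [Pi.smul_apply', smul_eq_mul]; module
  refine ⟨(hprod (hφ.norm_le x) (hG.norm_le x)).trans
    (by linarith [mul_nonneg hφ.nonneg hG.nonneg]), ?_⟩
  rw [hleibniz, two_mul]
  exact norm_add_le_of_le (hprod (hφ.norm_le _) (lipBound_iff.1 hG d x).2)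
    (hprod (lipBound_iff.1 hφ d x).2 (hG.norm_le x))

theorem lipBound_of_hasDerivAt {G' : ℝ → F} (hG : ∀ x, HasDerivAt G (G' x) x)
    (hc : ∀ x, ‖G x‖ ≤ c) (hc' : ∀ x, ‖G' x‖ ≤ c) : LipBound c G := lipBound_iff.2 fun d x => by
  have hmvt := convex_univ.norm_image_sub_le_of_norm_hasDerivWithin_le
    (fun y _ => (hG y).hasDerivWithinAt) (fun y _ => hc' y) (Set.mem_univ x) (Set.mem_univ (x + d))
  rw [add_sub_cancel_left] at hmvt
  refine ⟨hc x, ?_⟩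
  rw [norm_smul, norm_inv]
  exact inv_mul_le_of_le_mul₀ (norm_nonneg d) ((norm_nonneg _).trans (hc x))
    (hmvt.trans_eq (mul_comm _ _))

theorem SmoothPeriodic.exists_lipBound {T L : ℝ} {f : ℝ → ℝ → F} (hf : SmoothPeriodic 1 T L f)
    (hT : 0 < T) (hL : 0 < L) : ∃ c, ∀ t ∈ Set.Icc 0 T, LipBound c (f t) := by
  obtain ⟨c, hc⟩ := hf.exists_norm_le hL
  obtain ⟨c', hc'⟩ := (SmoothPeriodic.dX (n := 0) hf hT).exists_norm_le hL
  exact ⟨max c c', fun t ht => lipBound_of_hasDerivAt (fun x => hf.smooth.hasDerivAt_dX ht x)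
    (fun x => (hc t ht x).trans (le_max_left _ _)) fun x => (hc' t ht x).trans (le_max_right _ _)⟩

end LipBound

section Stencil

variable {F G : Type*} [NormedAddCommGroup F] [NormedSpace ℝ F] [NormedAddCommGroup G]
  [NormedSpace ℝ G] {f : ℝ → ℝ → F} {T L c c' d h t : ℝ} {n : ℕ}

/-- The average of the values of `f` at the times `t ± h`. -/
def timeMean (h : ℝ) (f : ℝ → ℝ → F) (t : ℝ) : ℝ → F :=
  (2 : ℝ)⁻¹ • (f (t + h) + f (t - h))

/-- The central difference quotient of `f` in time, with nodes `t ± h`. -/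
def timeQuotient (h : ℝ) (f : ℝ → ℝ → F) (t : ℝ) : ℝ → F :=
  (2 * h)⁻¹ • (f (t + h) - f (t - h))

/-- The translate of `G` by `s`, as a curve `s ↦ translate s G` in the space of functions. -/
def translate (s : ℝ) (G : ℝ → F) : ℝ → F :=
  fun x => G (x + s)

/-- The central second difference quotient of `G` with increment `d`. -/
def secondDiff (d : ℝ) (G : ℝ → F) : ℝ → F :=
  (d ^ 2)⁻¹ • (translate d G - (2 : ℝ) • G + translate (-d) G)

theorem jet_translate (d x s : ℝ) (φ : ℝ → F) : jet d x (translate s φ) = jet d (x + s) φ := by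
  simp only [jet_apply, translate, add_right_comm]

theorem SmoothOnStrip.hasDerivOn_clm (hf : SmoothOnStrip (n + 1) T f) (ℓ : (ℝ → F) →L[ℝ] G) :
    HasDerivOn (fun s => ℓ (f s)) (fun s => ℓ (Zakharov.dT T f s)) (Set.Icc 0 T) :=
  HasDerivOn.clm_apply hf.hasDerivOn_dT ℓ

theorem SmoothOnStrip.hasDerivOn_clm_translate (hf : SmoothOnStrip (n + 1) T f)
    (ht : t ∈ Set.Icc 0 T) (ℓ : (ℝ → F) →L[ℝ] G) (S : Set ℝ) :
    HasDerivOn (fun s => ℓ (translate s (f t))) (fun s => ℓ (translate s (Zakharov.dX f t))) S :=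
  HasDerivOn.clm_apply (fun x s _ =>
    ((hf.hasDerivAt_dX ht (x + s)).comp_const_add x s).hasDerivWithinAt) ℓ

theorem norm_clm_timeMean_sub_le (hT : 0 < T) (hf : SmoothOnStrip 2 T f) (hh : 0 ≤ h)
    (ht : Set.Icc (t - h) (t + h) ⊆ Set.Icc 0 T) (ℓ : (ℝ → F) →L[ℝ] G)
    (hc : ∀ s ∈ Set.Icc 0 T, ‖ℓ (dT T (dT T f) s)‖ ≤ c) :
    ‖ℓ (timeMean h f t - f t)‖ ≤ c * h ^ 2 := by
  have hc0 : 0 ≤ c := (norm_nonneg _).trans (hc 0 (Set.left_mem_Icc.2 hT.le))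
  have htaylor := ((hf.hasDerivOn_clm ℓ).mono ht).norm_symm_add_le
    (((hf.dT hT).hasDerivOn_clm ℓ).mono ht) hc0 (fun s hs => hc s (ht hs)) (Set.right_mem_Icc.2 hh)
  have hsplit : timeMean h f t - f t = (2 : ℝ)⁻¹ • (f (t + h) + f (t - h) - (2 : ℝ) • f t) := by
    rw [timeMean]; module
  rw [hsplit, map_smul, map_sub, map_add, map_smul, norm_smul, norm_inv, Real.norm_two]
  linarith

theorem norm_clm_timeQuotient_sub_le (hT : 0 < T) (hf : SmoothOnStrip 3 T f) (hh : 0 < h)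
    (ht : Set.Icc (t - h) (t + h) ⊆ Set.Icc 0 T) (ℓ : (ℝ → F) →L[ℝ] G)
    (hc : ∀ s ∈ Set.Icc 0 T, ‖ℓ (dT T (dT T (dT T f)) s)‖ ≤ c) :
    ‖ℓ (timeQuotient h f t - dT T f t)‖ ≤ c * h ^ 2 := by
  have hc0 : 0 ≤ c := (norm_nonneg _).trans (hc 0 (Set.left_mem_Icc.2 hT.le))
  have htaylor := ((hf.hasDerivOn_clm ℓ).mono ht).norm_symm_sub_sub_le
    (((hf.dT hT).hasDerivOn_clm ℓ).mono ht) ((((hf.dT hT).dT hT).hasDerivOn_clm ℓ).mono ht) hc0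
    (fun s hs => hc s (ht hs)) (Set.right_mem_Icc.2 hh.le)
  have hsplit : timeQuotient h f t - dT T f t
      = (2 * h)⁻¹ • (f (t + h) - f (t - h) - (2 * h) • dT T f t) := by
    rw [timeQuotient, smul_sub _ _ ((2 * h) • _), inv_smul_smul₀ (by positivity)]
  rw [hsplit, map_smul, map_sub, map_sub, map_smul, norm_smul, norm_inv,
    Real.norm_of_nonneg (by positivity), inv_mul_le_iff₀ (by positivity)]
  exact htaylor.trans_eq (by ring)

theorem norm_clm_secondDiff_sub_le (hT : 0 < T) (hf : SmoothOnStrip 4 T f) (hd : 0 < d)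
    (ht : t ∈ Set.Icc 0 T) (ℓ : (ℝ → F) →L[ℝ] G)
    (hc : ∀ s, ‖ℓ (translate s (dX (dX (dX (dX f))) t))‖ ≤ c) :
    ‖ℓ (secondDiff d (f t) - dX (dX f) t)‖ ≤ 2 * c * d ^ 2 := by
  have hf₁ := hf.dX hT
  have hf₂ := hf₁.dX hT
  have htaylor := (hf.hasDerivOn_clm_translate ht ℓ _).norm_symm_add_sub_le
    (hf₁.hasDerivOn_clm_translate ht ℓ _) (hf₂.hasDerivOn_clm_translate ht ℓ _)
    ((hf₂.dX hT).hasDerivOn_clm_translate ht ℓ _) ((norm_nonneg _).trans (hc 0)) (t := 0)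
    (fun s _ => hc s) (Set.right_mem_Icc.2 hd.le)
  have hzero : ∀ φ : ℝ → F, translate 0 φ = φ := fun φ => funext fun x => by
    rw [translate, add_zero]
  have hsplit : secondDiff d (f t) - dX (dX f) t = (d ^ 2)⁻¹ • (translate d (f t)
      + translate (-d) (f t) - (2 : ℝ) • f t - d ^ 2 • dX (dX f) t) := by
    rw [secondDiff, smul_sub _ _ (d ^ 2 • _), inv_smul_smul₀ (by positivity)]
    module
  rw [zero_add, zero_sub, hzero, hzero] at htaylor
  rw [hsplit, map_smul, map_sub, map_sub, map_add, map_smul, map_smul, norm_smul, norm_inv,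
    Real.norm_of_nonneg (by positivity), inv_mul_le_iff₀ (by positivity)]
  linarith

theorem norm_clm_secondDiff_timeMean_sub_le (hT : 0 < T) (hf : SmoothOnStrip 4 T f) (hh : 0 ≤ h)
    (hd : 0 < d) (ht : Set.Icc (t - h) (t + h) ⊆ Set.Icc 0 T) (ℓ : (ℝ → F) →L[ℝ] G)
    (hc : ∀ s ∈ Set.Icc 0 T, ∀ y, ‖ℓ (translate y (dX (dX (dX (dX f))) s))‖ ≤ c)
    (hc' : ∀ s ∈ Set.Icc 0 T, ‖ℓ (dT T (dT T (dX (dX f))) s)‖ ≤ c') :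
    ‖ℓ (secondDiff d (timeMean h f t) - dX (dX f) t)‖ ≤ 2 * c * d ^ 2 + c' * h ^ 2 := by
  have hspace : ∀ s ∈ Set.Icc (t - h) (t + h),
      ‖ℓ (secondDiff d (f s) - dX (dX f) s)‖ ≤ 2 * c * d ^ 2 := fun s hs =>
    norm_clm_secondDiff_sub_le hT hf hd (ht hs) ℓ (hc s (ht hs))
  have hplus := hspace (t + h) (Set.right_mem_Icc.2 (by linarith))
  have hminus := hspace (t - h) (Set.left_mem_Icc.2 (by linarith))
  have htime := norm_clm_timeMean_sub_le hT ((hf.dX hT).dX hT) hh ht ℓ hc'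
  have hsplit : secondDiff d (timeMean h f t) - dX (dX f) t
      = (2 : ℝ)⁻¹ • ((secondDiff d (f (t + h)) - dX (dX f) (t + h))
        + (secondDiff d (f (t - h)) - dX (dX f) (t - h)))
        + (timeMean h (dX (dX f)) t - dX (dX f) t) := by
    funext x
    simp only [secondDiff, timeMean, translate, Pi.add_apply, Pi.sub_apply, Pi.smul_apply]
    module
  rw [hsplit, map_add, map_smul, map_add]
  refine norm_add_le_of_le ?_ htime
  rw [norm_smul, norm_inv, Real.norm_two]
  linarith [norm_add_le_of_le hplus hminus]

theorem SmoothPeriodic.exists_norm_timeQuotient_sub_le (hf : SmoothPeriodic 3 T L f) (hT : 0 < T)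
    (hL : 0 < L) : ∃ c, ∀ h > 0, ∀ t, Set.Icc (t - h) (t + h) ⊆ Set.Icc 0 T → ∀ x,
      ‖(timeQuotient h f t - Zakharov.dT T f t) x‖ ≤ c * h ^ 2 := by
  obtain ⟨c, hc⟩ := (((hf.dT hT).dT hT).dT hT).exists_norm_le hL
  exact ⟨c, fun h hh t ht x =>
    norm_clm_timeQuotient_sub_le hT hf.smooth hh ht (pointEval x) fun s hs => hc s hs x⟩

theorem SmoothPeriodic.exists_norm_secondDiff_sub_le (hf : SmoothPeriodic 4 T L f) (hT : 0 < T)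
    (hL : 0 < L) : ∃ c, ∀ h ≥ 0, ∀ d > 0, ∀ t, Set.Icc (t - h) (t + h) ⊆ Set.Icc 0 T → ∀ x,
      ‖(secondDiff d (timeMean h f t) - Zakharov.dX (Zakharov.dX f) t) x‖
        ≤ c * (h ^ 2 + d ^ 2) := by
  obtain ⟨c, hc⟩ := ((((hf.dX hT).dX hT).dX hT).dX hT).exists_norm_le hL
  obtain ⟨c', hc'⟩ := ((((hf.dX hT).dX hT).dT hT).dT hT).exists_norm_le hL
  refine ⟨max (2 * c) c', fun h hh d hd t ht x => ?_⟩
  have hbound := norm_clm_secondDiff_timeMean_sub_le hT hf.smooth hh hd ht (pointEval x)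
    (fun s hs y => hc s hs (x + y)) fun s hs => hc' s hs x
  refine hbound.trans ?_
  rw [mul_add, add_comm]
  gcongr
  exacts [le_max_right _ _, le_max_left _ _]

theorem SmoothPeriodic.exists_lipBound_timeMean_sub (hf : SmoothPeriodic 3 T L f) (hT : 0 < T)
    (hL : 0 < L) : ∃ c, ∀ h ≥ 0, ∀ t, Set.Icc (t - h) (t + h) ⊆ Set.Icc 0 T →
      LipBound (c * h ^ 2) (timeMean h f t - f t) := by
  obtain ⟨c, hc⟩ := ((hf.dT hT).dT hT).exists_lipBound hT hL
  exact ⟨c, fun h hh t ht d x => norm_clm_timeMean_sub_le hT (hf.smooth.of_le (by norm_num)) hh ht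
    (jet d x) fun s hs => hc s hs d x⟩

theorem SmoothPeriodic.exists_lipBound_timeQuotient_sub (hf : SmoothPeriodic 4 T L f) (hT : 0 < T)
    (hL : 0 < L) : ∃ c, ∀ h > 0, ∀ t, Set.Icc (t - h) (t + h) ⊆ Set.Icc 0 T →
      LipBound (c * h ^ 2) (timeQuotient h f t - Zakharov.dT T f t) := by
  obtain ⟨c, hc⟩ := (((hf.dT hT).dT hT).dT hT).exists_lipBound hT hL
  exact ⟨c, fun h hh t ht d x => norm_clm_timeQuotient_sub_le hT (hf.smooth.of_le (by norm_num)) hh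
    ht (jet d x) fun s hs => hc s hs d x⟩

theorem SmoothPeriodic.exists_lipBound_secondDiff_sub (hf : SmoothPeriodic 5 T L f) (hT : 0 < T)
    (hL : 0 < L) : ∃ c, ∀ h ≥ 0, ∀ d > 0, ∀ t, Set.Icc (t - h) (t + h) ⊆ Set.Icc 0 T →
      LipBound (c * (h ^ 2 + d ^ 2))
        (secondDiff d (timeMean h f t) - Zakharov.dX (Zakharov.dX f) t) := by
  obtain ⟨c, hc⟩ := ((((hf.dX hT).dX hT).dX hT).dX hT).exists_lipBound hT hL
  obtain ⟨c', hc'⟩ := ((((hf.dX hT).dX hT).dT hT).dT hT).exists_lipBound hT hL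
  refine ⟨max (2 * c) c', fun h hh d hd t ht δ x => ?_⟩
  have hbound := norm_clm_secondDiff_timeMean_sub_le hT (hf.smooth.of_le (by norm_num)) hh hd ht
    (jet δ x) (fun s hs y => by rw [jet_translate]; exact hc s hs δ (x + y))
    fun s hs => hc' s hs δ x
  refine hbound.trans ?_
  rw [mul_add, add_comm]
  gcongr
  exacts [le_max_right _ _, le_max_left _ _]

theorem LipBound.timeMean (hplus : LipBound c (f (t + h))) (hminus : LipBound c (f (t - h))) :
    LipBound c (timeMean h f t) := fun d x => by
  rw [Zakharov.timeMean, map_smul, map_add, norm_smul, norm_inv, Real.norm_two]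
  linarith [norm_add_le_of_le (hplus d x) (hminus d x)]

end Stencil

section Solution

variable {T L : ℝ} {E : ℝ → ℝ → ℂ} {N V : ℝ → ℝ → ℝ}

theorem deriv_eq_dT {F : Type*} [NormedAddCommGroup F] [NormedSpace ℝ F] {t : ℝ}
    (ht : t ∈ Set.Ioo 0 T) (f : ℝ → ℝ → F) (x : ℝ) : deriv (fun s => f s x) t = dT T f t x :=
  (derivWithin_of_mem_nhds (Icc_mem_nhds ht.1 ht.2)).symm

theorem iteratedDeriv_two_eq_dX {F : Type*} [NormedAddCommGroup F] [NormedSpace ℝ F]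
    (f : ℝ → ℝ → F) (t : ℝ) : iteratedDeriv 2 (f t) = dX (dX f) t := by
  rw [iteratedDeriv_succ, iteratedDeriv_one]; rfl

theorem IsSolution.schrodinger_eq (hsol : IsSolution T L E N V) {t : ℝ} (ht : t ∈ Set.Ioo 0 T) :
    Complex.I • dT T E t + dX (dX E) t = N t • E t := funext fun x => by
  have heq := hsol.eq_E t ht x
  rw [deriv_eq_dT ht, iteratedDeriv_two_eq_dX, ← Complex.real_smul] at heq
  exact heq

theorem IsSolution.dT_N_eq (hsol : IsSolution T L E N V) {t : ℝ} (ht : t ∈ Set.Ioo 0 T) :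
    dT T N t = dX (dX V) t := funext fun x => by
  rw [← deriv_eq_dT ht, hsol.eq_N t ht x, iteratedDeriv_two_eq_dX]

theorem IsSolution.dT_V_eq (hsol : IsSolution T L E N V) {t : ℝ} (ht : t ∈ Set.Ioo 0 T) :
    dT T V t = N t + fun x => ‖E t x‖ ^ 2 := funext fun x => by
  rw [← deriv_eq_dT ht, hsol.eq_V t ht x, Pi.add_apply]

theorem mem_Ioo_of_Icc_subset {t h : ℝ} (hh : 0 < h)
    (ht : Set.Icc (t - h) (t + h) ⊆ Set.Icc 0 T) : t ∈ Set.Ioo 0 T := by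
  have hleft := (ht (Set.left_mem_Icc.2 (by linarith))).1
  have hright := (ht (Set.right_mem_Icc.2 (by linarith))).2
  constructor <;> linarith

theorem IsSolution.exists_lipBound_schrodinger (hsol : IsSolution T L E N V) (hT : 0 < T)
    (hL : 0 < L) (hE : SmoothPeriodic 5 T L E) (hN : SmoothPeriodic 3 T L N) :
    ∃ c, ∀ h > 0, ∀ d > 0, ∀ t, Set.Icc (t - h) (t + h) ⊆ Set.Icc 0 T →
      LipBound (c * (h ^ 2 + d ^ 2)) (Complex.I • timeQuotient h E t
        + secondDiff d (timeMean h E t) - timeMean h N t • timeMean h E t) := by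
  obtain ⟨cQ, hQ⟩ := (hE.of_le (m := 4) (by norm_num)).exists_lipBound_timeQuotient_sub hT hL
  obtain ⟨cS, hS⟩ := hE.exists_lipBound_secondDiff_sub hT hL
  obtain ⟨cE, hmE⟩ := (hE.of_le (m := 3) (by norm_num)).exists_lipBound_timeMean_sub hT hL
  obtain ⟨cN, hmN⟩ := hN.exists_lipBound_timeMean_sub hT hL
  obtain ⟨bE, hbE⟩ := (hE.of_le (m := 1) (by norm_num)).exists_lipBound hT hL
  obtain ⟨bN, hbN⟩ := (hN.of_le (m := 1) (by norm_num)).exists_lipBound hT hL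
  refine ⟨|cQ + 2 * cN * bE + 2 * bN * cE| + cS, fun h hh d hd t ht => ?_⟩
  have hplus : LipBound bE (E (t + h)) := hbE _ (ht (Set.right_mem_Icc.2 (by linarith)))
  have hminus : LipBound bE (E (t - h)) := hbE _ (ht (Set.left_mem_Icc.2 (by linarith)))
  have hmem := mem_Ioo_of_Icc_subset hh ht
  have hsplit : Complex.I • timeQuotient h E t + secondDiff d (timeMean h E t)
      - timeMean h N t • timeMean h E t
      = Complex.I • (timeQuotient h E t - dT T E t)
        + (secondDiff d (timeMean h E t) - dX (dX E) t)
        - ((timeMean h N t - N t) • timeMean h E t + N t • (timeMean h E t - E t)) := by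
    have heq := hsol.schrodinger_eq hmem
    rw [smul_sub, sub_smul, smul_sub (N t), ← heq]
    abel
  rw [hsplit]
  refine (((hQ h hh t ht).I_smul.add (hS h hh.le d hd t ht)).sub
    (((hmN h hh.le t ht).smul (hplus.timeMean hminus)).add
      ((hbN t ⟨hmem.1.le, hmem.2.le⟩).smul (hmE h hh.le t ht)))).mono ?_
  nlinarith [le_abs_self (cQ + 2 * cN * bE + 2 * bN * cE), sq_nonneg h,
    mul_nonneg (abs_nonneg (cQ + 2 * cN * bE + 2 * bN * cE)) (sq_nonneg d)]

theorem IsSolution.exists_norm_wave_N (hsol : IsSolution T L E N V) (hT : 0 < T) (hL : 0 < L)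
    (hN : SmoothPeriodic 3 T L N) (hV : SmoothPeriodic 4 T L V) :
    ∃ c, ∀ h > 0, ∀ d > 0, ∀ t, Set.Icc (t - h) (t + h) ⊆ Set.Icc 0 T → ∀ x,
      ‖timeQuotient h N t x - secondDiff d (timeMean h V t) x‖ ≤ c * (h ^ 2 + d ^ 2) := by
  obtain ⟨cQ, hQ⟩ := hN.exists_norm_timeQuotient_sub_le hT hL
  obtain ⟨cS, hS⟩ := hV.exists_norm_secondDiff_sub_le hT hL
  refine ⟨|cQ| + cS, fun h hh d hd t ht x => ?_⟩
  have hsplit : timeQuotient h N t x - secondDiff d (timeMean h V t) x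
      = (timeQuotient h N t - dT T N t) x - (secondDiff d (timeMean h V t) - dX (dX V) t) x := by
    rw [hsol.dT_N_eq (mem_Ioo_of_Icc_subset hh ht), Pi.sub_apply, Pi.sub_apply]
    ring
  rw [hsplit]
  refine (norm_sub_le_of_le (hQ h hh t ht x) (hS h hh.le d hd t ht x)).trans ?_
  nlinarith [le_abs_self cQ, sq_nonneg h, mul_nonneg (abs_nonneg cQ) (sq_nonneg d)]

theorem IsSolution.exists_lipBound_wave_V (hsol : IsSolution T L E N V) (hT : 0 < T) (hL : 0 < L)
    (hE : SmoothPeriodic 3 T L E) (hN : SmoothPeriodic 3 T L N) (hV : SmoothPeriodic 4 T L V) :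
    ∃ c, ∀ h > 0, ∀ t, Set.Icc (t - h) (t + h) ⊆ Set.Icc 0 T →
      LipBound (c * h ^ 2) (timeQuotient h V t - timeMean h N t
        - timeMean h (fun s x => ‖E s x‖ ^ 2) t) := by
  obtain ⟨cQ, hQ⟩ := hV.exists_lipBound_timeQuotient_sub hT hL
  obtain ⟨cN, hmN⟩ := hN.exists_lipBound_timeMean_sub hT hL
  obtain ⟨cP, hmP⟩ := hE.norm_sq.exists_lipBound_timeMean_sub hT hL
  refine ⟨cQ + cN + cP, fun h hh t ht => ?_⟩
  have hsplit : timeQuotient h V t - timeMean h N t - timeMean h (fun s x => ‖E s x‖ ^ 2) t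
      = (timeQuotient h V t - dT T V t) - (timeMean h N t - N t)
        - (timeMean h (fun s x => ‖E s x‖ ^ 2) t - fun x => ‖E t x‖ ^ 2) := by
    rw [hsol.dT_V_eq (mem_Ioo_of_Icc_subset hh ht)]
    abel
  rw [hsplit, add_mul, add_mul]
  exact ((hQ h hh t ht).sub (hmN h hh.le t ht)).sub (hmP h hh.le t ht)

end Solution

section Sample

variable {F : Type*} [NormedAddCommGroup F] [NormedSpace ℝ F] {dt dx T L : ℝ} {K m : ℕ}

theorem sample_zero {F : Type*} (dt dx : ℝ) (f : ℝ → ℝ → F) (k : ℤ) :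
    sample dt dx f 0 k = f 0 (k * dx) := by
  rw [sample, Nat.cast_zero, zero_mul]

theorem periodic_sample {F : Type*} {f : ℝ → ℝ → F} (hf : Periodic (f (m * dt)) L)
    (hdx : K * dx = L) : Periodic (sample dt dx f m) (K : ℤ) := fun k => by
  have hshift : ((k + (K : ℤ) : ℤ) : ℝ) * dx = k * dx + L := by push_cast; linarith
  rw [sample, hshift]
  exact hf _

theorem dtPlus_sample (dt dx : ℝ) (f : ℝ → ℝ → F) (m : ℕ) (k : ℤ) :
    dtPlus dt (sample dt dx f) m k = timeQuotient (dt / 2) f ((m + 1 / 2) * dt) (k * dx) := by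
  have hplus : (m + 1 / 2) * dt + dt / 2 = (m + 1 : ℕ) * dt := by push_cast; ring
  have hminus : (m + 1 / 2) * dt - dt / 2 = m * dt := by ring
  rw [timeQuotient, hplus, hminus, mul_div_cancel₀ dt two_ne_zero]
  rfl

theorem mtPlus_sample (dt dx : ℝ) (f : ℝ → ℝ → F) (m : ℕ) (k : ℤ) :
    mtPlus (sample dt dx f) m k = timeMean (dt / 2) f ((m + 1 / 2) * dt) (k * dx) := by
  have hplus : (m + 1 / 2) * dt + dt / 2 = (m + 1 : ℕ) * dt := by push_cast; ring
  have hminus : (m + 1 / 2) * dt - dt / 2 = m * dt := by ring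
  rw [timeMean, hplus, hminus]
  rfl

theorem dxTwo_eq_secondDiff {v : ℤ → F} {G : ℝ → F} (hv : ∀ k : ℤ, v k = G (k * dx)) (k : ℤ) :
    dxTwo dx v k = secondDiff dx G (k * dx) := by
  have hplus : ((k + 1 : ℤ) : ℝ) * dx = k * dx + dx := by push_cast; ring
  have hminus : ((k - 1 : ℤ) : ℝ) * dx = k * dx + -dx := by push_cast; ring
  rw [dxTwo, hv, hv, hv, hplus, hminus]
  rfl

theorem LipBound.norm_dxPlus_le {c : ℝ} {v : ℤ → F} {G : ℝ → F} (hG : LipBound c G)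
    (hv : ∀ k : ℤ, v k = G (k * dx)) (k : ℤ) : ‖dxPlus dx v k‖ ≤ c := by
  have hplus : ((k + 1 : ℤ) : ℝ) * dx = k * dx + dx := by push_cast; ring
  rw [dxPlus, hv, hv, hplus]
  exact (lipBound_iff.1 hG dx (k * dx)).2

theorem Icc_time_step_subset (hdt : 0 < dt) (hm : (m + 1) * dt ≤ T) :
    Set.Icc ((m + 1 / 2) * dt - dt / 2) ((m + 1 / 2) * dt + dt / 2) ⊆ Set.Icc 0 T :=
  Set.Icc_subset_Icc (by ring_nf; positivity) (by linarith)

theorem SmoothPeriodic.exists_norm_dtPlus_sample_le {f : ℝ → ℝ → F} (hf : SmoothPeriodic 1 T L f)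
    (hT : 0 < T) (hL : 0 < L) : ∃ c, ∀ dt > 0, ∀ dx, ∀ m : ℕ, (m + 1) * dt ≤ T → ∀ k,
      ‖dtPlus dt (sample dt dx f) m k‖ ≤ c := by
  obtain ⟨c, hc⟩ := (hf.dT (n := 0) hT).exists_norm_le hL
  refine ⟨c, fun dt hdt dx m hm k => ?_⟩
  have hsub : Set.Icc (m * dt) ((m + 1 : ℕ) * dt) ⊆ Set.Icc 0 T :=
    Set.Icc_subset_Icc (by positivity) (by exact_mod_cast hm)
  have hmvt := ((hf.smooth.hasDerivOn_dT (n := 0) (k * dx)).mono hsub).norm_sub_le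
    (by push_cast; linarith) fun s hs => hc s (hsub hs) (k * dx)
  have hlen : ((m + 1 : ℕ) : ℝ) * dt - m * dt = dt := by push_cast; ring
  rw [hlen] at hmvt
  rw [dtPlus, norm_smul, norm_inv, Real.norm_of_nonneg hdt.le]
  exact inv_mul_le_of_le_mul₀ hdt.le ((norm_nonneg _).trans (hc 0 ⟨le_rfl, hT.le⟩ 0))
    (hmvt.trans_eq (mul_comm _ _))

/-- The mesh values of a triple of functions. -/
def sampleTriple (dt dx : ℝ) (E : ℝ → ℝ → ℂ) (N V : ℝ → ℝ → ℝ) : MeshTriple :=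
  ⟨sample dt dx E, sample dt dx N, sample dt dx V⟩

variable {E : ℝ → ℝ → ℂ} {N V : ℝ → ℝ → ℝ}

theorem IsSolution.periodicAt_sampleTriple (hsol : IsSolution T L E N V)
    (hm : m * dt ∈ Set.Icc 0 T) (hdx : K * dx = L) : (sampleTriple dt dx E N V).PeriodicAt K m :=
  ⟨periodic_sample (hsol.periodic_E _ hm) hdx, periodic_sample (hsol.periodic_N _ hm) hdx,
    periodic_sample (hsol.periodic_V _ hm) hdx⟩

open MeshTriple

theorem residualE_sampleTriple (dt dx : ℝ) (E : ℝ → ℝ → ℂ) (N V : ℝ → ℝ → ℝ) (m : ℕ) (k : ℤ) :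
    residualE dt dx (sampleTriple dt dx E N V) m k
      = (Complex.I • timeQuotient (dt / 2) E ((m + 1 / 2) * dt)
        + secondDiff dx (timeMean (dt / 2) E ((m + 1 / 2) * dt))
        - timeMean (dt / 2) N ((m + 1 / 2) * dt) • timeMean (dt / 2) E ((m + 1 / 2) * dt))
          (k * dx) := by
  rw [residualE, sampleTriple, dtPlus_sample, dxTwo_eq_secondDiff (mtPlus_sample dt dx E m),
    mtPlus_sample, mtPlus_sample]
  rfl

theorem residualN_sampleTriple (dt dx : ℝ) (E : ℝ → ℝ → ℂ) (N V : ℝ → ℝ → ℝ) (m : ℕ) (k : ℤ) :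
    residualN dt dx (sampleTriple dt dx E N V) m k
      = timeQuotient (dt / 2) N ((m + 1 / 2) * dt) (k * dx)
        - secondDiff dx (timeMean (dt / 2) V ((m + 1 / 2) * dt)) (k * dx) := by
  rw [residualN, sampleTriple, dtPlus_sample, dxTwo_eq_secondDiff (mtPlus_sample dt dx V m)]

theorem residualV_sampleTriple (dt dx : ℝ) (E : ℝ → ℝ → ℂ) (N V : ℝ → ℝ → ℝ) (m : ℕ) (k : ℤ) :
    residualV dt (sampleTriple dt dx E N V) m k
      = (timeQuotient (dt / 2) V ((m + 1 / 2) * dt) - timeMean (dt / 2) N ((m + 1 / 2) * dt)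
        - timeMean (dt / 2) (fun s x => ‖E s x‖ ^ 2) ((m + 1 / 2) * dt)) (k * dx) := by
  have hsq : (fun j l => ‖sample dt dx E j l‖ ^ 2) = sample dt dx fun s x => ‖E s x‖ ^ 2 := rfl
  rw [residualV, sampleTriple, hsq, dtPlus_sample, mtPlus_sample, mtPlus_sample]
  rfl

/-- The residuals of `w` in the norms in which the stability estimate needs them, at the time
level `m`. -/
structure MeshTriple.ResidualBound (dt dx R : ℝ) (w : MeshTriple) (m : ℕ) : Prop where
  residualE : ∀ k, ‖residualE dt dx w m k‖ ≤ R
  dxPlus_residualE : ∀ k, ‖dxPlus dx (MeshTriple.residualE dt dx w m) k‖ ≤ R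
  residualN : ∀ k, ‖residualN dt dx w m k‖ ≤ R
  dxPlus_residualV : ∀ k, ‖dxPlus dx (residualV dt w m) k‖ ≤ R

theorem IsSolution.exists_residualBound (hsol : IsSolution T L E N V) (hT : 0 < T) (hL : 0 < L)
    (hE : SmoothPeriodic 5 T L E) (hN : SmoothPeriodic 3 T L N) (hV : SmoothPeriodic 4 T L V) :
    ∃ c, ∀ dt > 0, ∀ dx > 0, ∀ m : ℕ, (m + 1) * dt ≤ T →
      ResidualBound dt dx (c * (dt ^ 2 + dx ^ 2)) (sampleTriple dt dx E N V) m := by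
  obtain ⟨cE, hcE⟩ := hsol.exists_lipBound_schrodinger hT hL hE hN
  obtain ⟨cN, hcN⟩ := hsol.exists_norm_wave_N hT hL hN hV
  obtain ⟨cV, hcV⟩ := hsol.exists_lipBound_wave_V hT hL (hE.of_le (by norm_num)) hN hV
  refine ⟨|cE| + |cN| + |cV|, fun dt hdt dx hdx m hm => ?_⟩
  have ht := Icc_time_step_subset hdt hm
  have hdt2 : 0 < dt / 2 := half_pos hdt
  have hmono : ∀ c, |c| ≤ |cE| + |cN| + |cV| → ∀ y, 0 ≤ y → y ≤ dt ^ 2 + dx ^ 2 →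
      c * y ≤ (|cE| + |cN| + |cV|) * (dt ^ 2 + dx ^ 2) := fun c hc y hy hy' =>
    mul_le_mul ((le_abs_self c).trans hc) hy' hy (by positivity)
  have hsq : (dt / 2) ^ 2 ≤ dt ^ 2 := pow_le_pow_left₀ hdt2.le (by linarith) 2
  have hE' := hcE _ hdt2 dx hdx _ ht
  have hEle := hmono cE (by linarith [abs_nonneg cN, abs_nonneg cV]) ((dt / 2) ^ 2 + dx ^ 2)
    (by positivity) (by linarith)
  have hNle := hmono cN (by linarith [abs_nonneg cE, abs_nonneg cV]) ((dt / 2) ^ 2 + dx ^ 2)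
    (by positivity) (by linarith)
  have hVle := hmono cV (by linarith [abs_nonneg cE, abs_nonneg cN]) ((dt / 2) ^ 2)
    (by positivity) (by linarith [sq_nonneg dx])
  refine ⟨fun k => ?_, fun k => ?_, fun k => ?_, fun k => ?_⟩
  · rw [residualE_sampleTriple]
    exact (hE'.norm_le _).trans hEle
  · exact (hE'.norm_dxPlus_le (residualE_sampleTriple dt dx E N V m) k).trans hEle
  · rw [residualN_sampleTriple]
    exact (hcN _ hdt2 dx hdx _ ht _).trans hNle
  · exact ((hcV _ hdt2 _ ht).norm_dxPlus_le (residualV_sampleTriple dt dx E N V m) k).trans hVle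

end Sample

section Convergence

open MeshTriple

variable {T L CV dt dx B R c : ℝ} {E : ℝ → ℝ → ℂ} {N V : ℝ → ℝ → ℝ} {M K m : ℕ} {u w : MeshTriple}

theorem meshNorm_sq_le_of_norm_le {F : Type*} [NormedAddCommGroup F] (hdx : 0 ≤ dx) {v : ℤ → F}
    (hv : ∀ k, ‖v k‖ ≤ c) : meshNorm dx K v ^ 2 ≤ K * dx * c ^ 2 := by
  rw [meshNorm_sq hdx, ← meshSum_const]
  exact meshSum_mono hdx fun k => pow_le_pow_left₀ (norm_nonneg _) (hv k) 2

theorem meshNorm_sq_le_of_sub {F : Type*} [NormedAddCommGroup F] (hdx : 0 ≤ dx) (v z : ℤ → F) :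
    meshNorm dx K v ^ 2 ≤ 2 * meshNorm dx K (v - z) ^ 2 + 2 * meshNorm dx K z ^ 2 := by
  rw [meshNorm_sq hdx, meshNorm_sq hdx, meshNorm_sq hdx, ← meshSum_const_mul, ← meshSum_const_mul,
    ← meshSum_add]
  refine meshSum_mono hdx fun k => ?_
  have htriangle : ‖v k‖ ≤ ‖(v - z) k‖ + ‖z k‖ := by
    simpa only [Pi.sub_apply, sub_add_cancel] using norm_add_le ((v - z) k) (z k)
  nlinarith [pow_le_pow_left₀ (norm_nonneg _) htriangle 2, sq_nonneg (‖(v - z) k‖ - ‖z k‖)]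

theorem energy_zero_right_le (hdx : 0 ≤ dx) (hE : ∀ k, ‖u.E m k‖ ≤ c)
    (hEx : ∀ k, ‖dxPlus dx (u.E m) k‖ ≤ c) (hN : ∀ k, ‖u.N m k‖ ≤ c) :
    energy dx K u 0 m ≤ K * dx * (c ^ 2 + c ^ 2 / 2 + c ^ 3)
      + 2⁻¹ * meshNorm dx K (dxPlus dx (u.V m)) ^ 2 := by
  rw [meshNorm_sq hdx, ← meshSum_const, ← meshSum_const_mul, ← meshSum_add]
  refine meshSum_mono hdx fun k => ?_
  have hE2 := pow_le_pow_left₀ (norm_nonneg _) (hE k) 2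
  have hEx2 := pow_le_pow_left₀ (norm_nonneg _) (hEx k) 2
  have hN2 := pow_le_pow_left₀ (norm_nonneg _) (hN k) 2
  have hcoupling : u.N m k * ‖u.E m k‖ ^ 2 ≤ c * c ^ 2 :=
    mul_le_mul ((le_abs_self _).trans (hN k)) hE2 (sq_nonneg _) ((norm_nonneg _).trans (hN k))
  simp only [energyDensity, gapSq, MeshTriple.sub_zero, zero_E, zero_N, Pi.zero_apply, norm_zero,
    Real.norm_eq_abs, sq_abs] at hN2 ⊢
  nlinarith

theorem IsDVDM.stepBound (h : IsDVDM dt dx M K u.E u.N u.V) (hm : m < M)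
    (hw : ResidualBound dt dx R w m) (hE : ∀ k, ‖dtPlus dt w.E m k‖ ≤ B)
    (hN : ∀ k, ‖dtPlus dt w.N m k‖ ≤ B) : StepBound dt dx B R u w m := by
  have hneg : ∀ {F : Type} [NormedAddCommGroup F] [NormedSpace ℝ F] (v : ℤ → F) (k : ℤ),
      ‖dxPlus dx (0 - v) k‖ = ‖dxPlus dx v k‖ := fun v k => by
    rw [dxPlus, dxPlus, norm_smul, norm_smul, Pi.sub_apply, Pi.sub_apply, Pi.zero_apply,
      Pi.zero_apply, sub_sub_sub_cancel_left, norm_sub_rev]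
  refine ⟨hE, hN, fun k => ?_, fun k => ?_, fun k => ?_, fun k => ?_⟩
  · rw [gapE, h.residualE_eq_zero hm, zero_sub, Pi.neg_apply, norm_neg]
    exact hw.residualE k
  · rw [gapE, h.residualE_eq_zero hm, hneg]
    exact hw.dxPlus_residualE k
  · rw [gapN, h.residualN_eq_zero hm, zero_sub, Pi.neg_apply, norm_neg]
    exact hw.residualN k
  · rw [gapV, h.residualV_eq_zero hm, hneg]
    exact hw.dxPlus_residualV k

/-- `u` is a solution of the scheme on the mesh `Δt = T / M`, `Δx = L / K`, started from the values
of `(E, N, V)`, up to an error in `V` of second order in the discrete gradient norm. -/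
structure IsApproximation (T L CV : ℝ) (E : ℝ → ℝ → ℂ) (N V : ℝ → ℝ → ℝ) (dt dx : ℝ) (M K : ℕ)
    (u : MeshTriple) : Prop where
  dt_pos : 0 < dt
  dx_pos : 0 < dx
  K_pos : 0 < K
  time_mesh : M * dt = T
  space_mesh : K * dx = L
  isDVDM : IsDVDM dt dx M K u.E u.N u.V
  E_zero : u.E 0 = sample dt dx E 0
  N_zero : u.N 0 = sample dt dx N 0
  V_zero : meshNorm dx K (dxPlus dx ((u - sampleTriple dt dx E N V).V 0)) ≤ CV * dx ^ 2

theorem IsApproximation.mul_dt_mem (h : IsApproximation T L CV E N V dt dx M K u) (hm : m ≤ M) :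
    m * dt ∈ Set.Icc 0 T := by
  have hdt := h.dt_pos
  refine ⟨by positivity, ?_⟩
  rw [← h.time_mesh]
  gcongr

theorem IsApproximation.V_zero_sq (h : IsApproximation T L CV E N V dt dx M K u) :
    meshNorm dx K (dxPlus dx ((u - sampleTriple dt dx E N V).V 0)) ^ 2 ≤ (CV * dx ^ 2) ^ 2 :=
  pow_le_pow_left₀ (meshNorm_nonneg _) h.V_zero 2

theorem IsApproximation.dx_le (h : IsApproximation T L CV E N V dt dx M K u) : dx ≤ L := by
  rw [← h.space_mesh]
  exact le_mul_of_one_le_left h.dx_pos.le (by exact_mod_cast h.K_pos)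

theorem IsApproximation.dirichlet_V_zero_le (h : IsApproximation T L CV E N V dt dx M K u)
    (hc : ∀ k, ‖dxPlus dx (sample dt dx V 0) k‖ ≤ c) :
    meshNorm dx K (dxPlus dx (u.V 0)) ^ 2 ≤ 2 * (CV ^ 2 * L ^ 4) + 2 * (L * c ^ 2) := by
  have hsub : dxPlus dx (u.V 0) - dxPlus dx (sample dt dx V 0)
      = dxPlus dx ((u - sampleTriple dt dx E N V).V 0) :=
    funext fun k => (dxPlus_sub dx (u.V 0) (sample dt dx V 0) k).symm
  have hsplit := meshNorm_sq_le_of_sub (K := K) h.dx_pos.le (dxPlus dx (u.V 0))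
    (dxPlus dx (sample dt dx V 0))
  have hsample := meshNorm_sq_le_of_norm_le (K := K) h.dx_pos.le hc
  have hdx4 : CV ^ 2 * dx ^ 4 ≤ CV ^ 2 * L ^ 4 := by
    gcongr
    exacts [h.dx_pos.le, h.dx_le]
  rw [hsub] at hsplit
  rw [h.space_mesh] at hsample
  linarith [h.V_zero_sq, show (CV * dx ^ 2) ^ 2 = CV ^ 2 * dx ^ 4 by ring]

theorem SmoothPeriodic.exists_norm_sample_zero_le {F : Type*} [NormedAddCommGroup F]
    [NormedSpace ℝ F] {f : ℝ → ℝ → F} (hf : SmoothPeriodic 1 T L f) (hT : 0 < T) (hL : 0 < L) :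
    ∃ c, ∀ dt dx k, ‖sample dt dx f 0 k‖ ≤ c ∧ ‖dxPlus dx (sample dt dx f 0) k‖ ≤ c := by
  obtain ⟨c, hc⟩ := hf.exists_lipBound hT hL
  have h0 : LipBound c (f 0) := hc 0 ⟨le_rfl, hT.le⟩
  exact ⟨c, fun dt dx k => ⟨by rw [sample_zero]; exact h0.norm_le _,
    h0.norm_dxPlus_le (sample_zero dt dx f) k⟩⟩

theorem exists_norm_E_le (hT : 0 < T) (hL : 0 < L) (hE : SmoothPeriodic 1 T L E)
    (hN : SmoothPeriodic 1 T L N) (hV : SmoothPeriodic 1 T L V) (CV : ℝ) :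
    ∃ B, ∀ {dt dx M K u}, IsApproximation T L CV E N V dt dx M K u →
      ∀ m ≤ M, ∀ k, ‖u.E m k‖ ≤ B := by
  obtain ⟨cE, hcE⟩ := hE.exists_norm_sample_zero_le hT hL
  obtain ⟨cN, hcN⟩ := hN.exists_norm_sample_zero_le hT hL
  obtain ⟨cV, hcV⟩ := hV.exists_norm_sample_zero_le hT hL
  set c := max cE cN
  set η := L * (c ^ 2 + c ^ 2 / 2 + c ^ 3) + 2⁻¹ * (2 * (CV ^ 2 * L ^ 4) + 2 * (L * cV ^ 2))
  refine ⟨√(supBound L (L * c ^ 2) η), fun {dt dx M K u} h m hm k => Real.le_sqrt_of_sq_le ?_⟩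
  have hE0 : ∀ k, ‖u.E 0 k‖ ≤ c := fun k => by
    rw [h.E_zero]; exact (hcE dt dx k).1.trans (le_max_left _ _)
  have hEx0 : ∀ k, ‖dxPlus dx (u.E 0) k‖ ≤ c := fun k => by
    rw [h.E_zero]; exact (hcE dt dx k).2.trans (le_max_left _ _)
  have hN0 : ∀ k, ‖u.N 0 k‖ ≤ c := fun k => by
    rw [h.N_zero]; exact (hcN dt dx k).1.trans (le_max_right _ _)
  have hmass : mass dx K u 0 0 ≤ L * c ^ 2 := by
    rw [mass, MeshTriple.sub_zero, ← h.space_mesh]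
    exact meshNorm_sq_le_of_norm_le h.dx_pos.le hE0
  have henergy : energy dx K u 0 0 ≤ η := by
    have hbound := energy_zero_right_le (K := K) h.dx_pos.le hE0 hEx0 hN0
    rw [h.space_mesh] at hbound
    refine hbound.trans (add_le_add le_rfl (mul_le_mul_of_nonneg_left ?_ (by norm_num)))
    exact h.dirichlet_V_zero_le fun k => (hcV dt dx k).2
  have hsup := h.isDVDM.norm_E_sq_le h.dt_pos.ne' h.dx_pos h.K_pos hmass henergy hm k
  rwa [h.space_mesh] at hsup

theorem IsSolution.exists_boundedAt_stepBound (hsol : IsSolution T L E N V) (hT : 0 < T)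
    (hL : 0 < L) (hE : SmoothPeriodic 5 T L E) (hN : SmoothPeriodic 3 T L N)
    (hV : SmoothPeriodic 4 T L V) (CV : ℝ) :
    ∃ B ≥ 1, ∃ c, ∀ {dt dx M K u}, IsApproximation T L CV E N V dt dx M K u →
      (∀ m ≤ M, BoundedAt B u (sampleTriple dt dx E N V) m) ∧
      ∀ m < M, StepBound dt dx B (c * (dt ^ 2 + dx ^ 2)) u (sampleTriple dt dx E N V) m := by
  have hE1 := hE.of_le (m := 1) (by norm_num)
  have hN1 := hN.of_le (m := 1) (by norm_num)
  obtain ⟨Bu, hBu⟩ := exists_norm_E_le hT hL hE1 hN1 (hV.of_le (by norm_num)) CV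
  obtain ⟨BE, hBE⟩ := hE.exists_norm_le hL
  obtain ⟨BN, hBN⟩ := hN.exists_norm_le hL
  obtain ⟨BE', hBE'⟩ := hE1.exists_norm_dtPlus_sample_le hT hL
  obtain ⟨BN', hBN'⟩ := hN1.exists_norm_dtPlus_sample_le hT hL
  obtain ⟨c, hc⟩ := hsol.exists_residualBound hT hL hE hN hV
  obtain ⟨B, hB⟩ := ({1, Bu, BE, BN, BE', BN'} : Set ℝ).toFinite.bddAbove
  simp only [upperBounds, Set.mem_insert_iff, Set.mem_singleton_iff, forall_eq_or_imp, forall_eq,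
    Set.mem_ofPred_eq] at hB
  obtain ⟨h1, hu, hwE, hwN, hwE', hwN'⟩ := hB
  refine ⟨B, h1, c, fun {dt dx M K u} h => ⟨fun m hm => ⟨fun k => (hBu h m hm k).trans hu,
    fun k => (hBE _ (h.mul_dt_mem hm) _).trans hwE,
    fun k => (hBN _ (h.mul_dt_mem hm) _).trans hwN⟩, fun m hm => ?_⟩⟩
  have hstep : (m + 1) * dt ≤ T := by exact_mod_cast (h.mul_dt_mem (Nat.succ_le_of_lt hm)).2
  exact h.isDVDM.stepBound hm (hc dt h.dt_pos dx h.dx_pos m hstep)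
    (fun k => (hBE' dt h.dt_pos dx m hstep k).trans hwE')
    fun k => (hBN' dt h.dt_pos dx m hstep k).trans hwN'

theorem IsSolution.exists_errorFunctional_le (hsol : IsSolution T L E N V) (hT : 0 < T)
    (hL : 0 < L) (hE : SmoothPeriodic 5 T L E) (hN : SmoothPeriodic 3 T L N)
    (hV : SmoothPeriodic 4 T L V) (CV : ℝ) :
    ∃ C > 0, ∃ ε > 0, ∀ {dt dx M K u}, IsApproximation T L CV E N V dt dx M K u → dt < ε →
      ∀ m ≤ M, errorFunctional dx K (u.E m - sample dt dx E m) (u.N m - sample dt dx N m)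
        (u.V m - sample dt dx V m) ≤ C ^ 2 * (dt ^ 2 + dx ^ 2) ^ 2 := by
  obtain ⟨B, hB1, c, hbounds⟩ := hsol.exists_boundedAt_stepBound hT hL hE hN hV CV
  have : 0 < B := by linarith
  set A := 4 * (Real.exp (4 * (148 * B ^ 3) * T) * (CV ^ 2 / 2 + L * c ^ 2))
  have hA : 0 ≤ A := by positivity
  refine ⟨A + 1, by positivity, (2 * (148 * B ^ 3))⁻¹, by positivity,
    fun {dt dx M K u} h hdt m hm => ?_⟩
  obtain ⟨hbounded, hstep⟩ := hbounds h
  have hdt0 := h.dt_pos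
  have hsmall : 148 * B ^ 3 * dt ≤ 1 / 2 := by
    have hlt := (lt_inv_mul_iff₀ (by positivity : 0 < 2 * (148 * B ^ 3))).1
      (hdt.trans_eq (mul_one _).symm)
    linarith
  have hstable := stability h.dt_pos h.dx_pos.le hB1 (fun j hj => h.isDVDM.periodicAt hj)
    (fun j hj => hsol.periodicAt_sampleTriple (h.mul_dt_mem hj) h.space_mesh) hbounded hstep
    hsmall hm
  rw [lyapunov_of_E_N_eq h.dx_pos.le h.E_zero h.N_zero, h.space_mesh] at hstable
  have hinit : meshNorm dx K (dxPlus dx ((u - sampleTriple dt dx E N V).V 0)) ^ 2 / 2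
      ≤ CV ^ 2 / 2 * (dt ^ 2 + dx ^ 2) ^ 2 := by
    have hsq : (dx ^ 2) ^ 2 ≤ (dt ^ 2 + dx ^ 2) ^ 2 := by gcongr; linarith [sq_nonneg dt]
    nlinarith [h.V_zero_sq, mul_le_mul_of_nonneg_left hsq (sq_nonneg CV)]
  have htime : 4 * (148 * B ^ 3 * dt) * m ≤ 4 * (148 * B ^ 3) * T := by
    rw [← mul_assoc 4, mul_assoc _ dt, mul_comm dt]
    gcongr
    exact (h.mul_dt_mem hm).2
  calc _ ≤ 4 * (Real.exp (4 * (148 * B ^ 3 * dt) * m)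
        * (meshNorm dx K (dxPlus dx ((u - sampleTriple dt dx E N V).V 0)) ^ 2 / 2
          + L * (c * (dt ^ 2 + dx ^ 2)) ^ 2)) := hstable
    _ ≤ 4 * (Real.exp (4 * (148 * B ^ 3) * T) * (CV ^ 2 / 2 * (dt ^ 2 + dx ^ 2) ^ 2
          + L * (c * (dt ^ 2 + dx ^ 2)) ^ 2)) := by gcongr
    _ = A * (dt ^ 2 + dx ^ 2) ^ 2 := by ring
    _ ≤ (A + 1) ^ 2 * (dt ^ 2 + dx ^ 2) ^ 2 := by gcongr; nlinarith

theorem meshNorm_le_of_errorFunctional_le {eE : ℤ → ℂ} {eN eV : ℤ → ℝ} {s : ℝ} (hs : 0 ≤ s)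
    (h : errorFunctional dx K eE eN eV ≤ s ^ 2) :
    meshNorm dx K eE ≤ s ∧ meshNorm dx K (dxPlus dx eE) ≤ s ∧ meshNorm dx K eN ≤ s ∧
      meshNorm dx K (dxPlus dx eV) ≤ s := by
  rw [errorFunctional] at h
  have hE := sq_nonneg (meshNorm dx K eE)
  have hEx := sq_nonneg (meshNorm dx K (dxPlus dx eE))
  have hN := sq_nonneg (meshNorm dx K eN)
  have hVx := sq_nonneg (meshNorm dx K (dxPlus dx eV))
  refine ⟨?_, ?_, ?_, ?_⟩ <;> exact (abs_le_of_sq_le_sq' (by linarith) hs).2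

theorem IsDVDM.isApproximation {Eₕ : ℕ → ℤ → ℂ} {Nₕ Vₕ : ℕ → ℤ → ℝ}
    (h : IsDVDM dt dx M K Eₕ Nₕ Vₕ) (hT : 0 < T) (hL : 0 < L) (hM : 0 < M) (hK : 0 < K)
    (hdt : dt = T / M) (hdx : dx = L / K) (hE : ∀ k, Eₕ 0 k = E 0 (k * dx))
    (hN : ∀ k, Nₕ 0 k = N 0 (k * dx))
    (hV : meshNorm dx K (dxPlus dx fun k : ℤ => Vₕ 0 k - V 0 (k * dx)) ≤ CV * dx ^ 2) :
    IsApproximation T L CV E N V dt dx M K ⟨Eₕ, Nₕ, Vₕ⟩ where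
  dt_pos := by rw [hdt]; positivity
  dx_pos := by rw [hdx]; positivity
  K_pos := hK
  time_mesh := by rw [hdt]; exact mul_div_cancel₀ T (Nat.cast_ne_zero.2 hM.ne')
  space_mesh := by rw [hdx]; exact mul_div_cancel₀ L (Nat.cast_ne_zero.2 hK.ne')
  isDVDM := h
  E_zero := funext fun k => (hE k).trans (sample_zero dt dx E k).symm
  N_zero := funext fun k => (hN k).trans (sample_zero dt dx N k).symm
  V_zero := by
    simp only [← sample_zero dt dx V] at hV
    exact hV

end Convergence

end Zakharov

end

theorem theorem3p3_general (T L : ℝ) (hT : 0 < T) (hL : 0 < L)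
    (E : ℝ → ℝ → ℂ) (N V : ℝ → ℝ → ℝ)
    (hsol : Zakharov.IsSolution T L E N V)
    (hE : Zakharov.SmoothOnStrip 5 T E) (hN : Zakharov.SmoothOnStrip 3 T N)
    (hV : Zakharov.SmoothOnStrip 4 T V)
    (CV : ℝ) :
    ∃ C : ℝ, 0 < C ∧ ∃ ε : ℝ, 0 < ε ∧ ∀ M K : ℕ, 0 < M → 0 < K →
      ∀ dt dx : ℝ, dt = T / M → dx = L / K → dt < ε →
      ∀ (Eₕ : ℕ → ℤ → ℂ) (Nₕ Vₕ : ℕ → ℤ → ℝ),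
        Zakharov.IsDVDM dt dx M K Eₕ Nₕ Vₕ →
        (∀ k, Eₕ 0 k = E 0 (k * dx)) →
        (∀ k, Nₕ 0 k = N 0 (k * dx)) →
        Zakharov.meshNorm dx K
          (Zakharov.dxPlus dx (fun k : ℤ => Vₕ 0 k - V 0 (k * dx))) ≤ CV * dx ^ 2 →
        ∀ m ≤ M, ∀ (eE : ℤ → ℂ) (eN eV : ℤ → ℝ),
          eE = Eₕ m - Zakharov.sample dt dx E m →
          eN = Nₕ m - Zakharov.sample dt dx N m →
          eV = Vₕ m - Zakharov.sample dt dx V m →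
          Zakharov.errorFunctional dx K eE eN eV ≤ C ^ 2 * (dt ^ 2 + dx ^ 2) ^ 2 ∧
          Zakharov.meshNorm dx K eE ≤ C * (dt ^ 2 + dx ^ 2) ∧
          Zakharov.meshNorm dx K (Zakharov.dxPlus dx eE) ≤ C * (dt ^ 2 + dx ^ 2) ∧
          Zakharov.meshNorm dx K eN ≤ C * (dt ^ 2 + dx ^ 2) ∧
          Zakharov.meshNorm dx K (Zakharov.dxPlus dx eV) ≤ C * (dt ^ 2 + dx ^ 2) := by
  obtain ⟨C, hC, ε, hε, herror⟩ := hsol.exists_errorFunctional_le hT hL ⟨hE, hsol.periodic_E⟩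
    ⟨hN, hsol.periodic_N⟩ ⟨hV, hsol.periodic_V⟩ CV
  refine ⟨C, hC, ε, hε, fun M K hM hK dt dx hdt hdx hdtε Eₕ Nₕ Vₕ hscheme hE0 hN0 hV0 m hm
    eE eN eV heE heN heV => ?_⟩
  have hfunctional := herror (hscheme.isApproximation hT hL hM hK hdt hdx hE0 hN0 hV0) hdtε m hm
  rw [← heE, ← heN, ← heV] at hfunctional
  refine ⟨hfunctional, Zakharov.meshNorm_le_of_errorFunctional_le (by positivity) ?_⟩
  rwa [mul_pow]

theorem theorem3p3 (T L : ℝ) (hT : 0 < T) (hL : 0 < L)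
    (E : ℝ → ℝ → ℂ) (N V : ℝ → ℝ → ℝ)
    (hsol : Zakharov.IsSolution T L E N V)
    (hE : Zakharov.SmoothOnStrip 5 T E) (hN : Zakharov.SmoothOnStrip 5 T N)
    (hV : Zakharov.SmoothOnStrip 5 T V)
    (CV : ℝ) :
    ∃ C : ℝ, 0 < C ∧ ∃ ε : ℝ, 0 < ε ∧ ∀ M K : ℕ, 0 < M → 0 < K → ∀ dt dx : ℝ, dt = T / M → dx = L / K →
      dt < ε → dx < ε →
      ∀ (Eₕ : ℕ → ℤ → ℂ) (Nₕ Vₕ : ℕ → ℤ → ℝ),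
        Zakharov.IsDVDM dt dx M K Eₕ Nₕ Vₕ →
        (∀ k, Eₕ 0 k = E 0 (k * dx)) →
        (∀ k, Nₕ 0 k = N 0 (k * dx)) →
        -- the initial value of `V` is second order accurate in the discrete gradient norm
        Zakharov.meshNorm dx K
          (Zakharov.dxPlus dx (fun k : ℤ => Vₕ 0 k - V 0 (k * dx))) ≤ CV * dx ^ 2 →
        ∀ m ≤ M, ∀ (eE : ℤ → ℂ) (eN eV : ℤ → ℝ),
          eE = Eₕ m - Zakharov.sample dt dx E m →
          eN = Nₕ m - Zakharov.sample dt dx N m →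
          eV = Vₕ m - Zakharov.sample dt dx V m →
          Zakharov.errorFunctional dx K eE eN eV ≤ C ^ 2 * (dt ^ 2 + dx ^ 2) ^ 2 ∧
          Zakharov.meshNorm dx K eE ≤ C * (dt ^ 2 + dx ^ 2) ∧
          Zakharov.meshNorm dx K (Zakharov.dxPlus dx eE) ≤ C * (dt ^ 2 + dx ^ 2) ∧
          Zakharov.meshNorm dx K eN ≤ C * (dt ^ 2 + dx ^ 2) ∧
          Zakharov.meshNorm dx K (Zakharov.dxPlus dx eV) ≤ C * (dt ^ 2 + dx ^ 2) := by
  obtain ⟨C, hC, ε, hε, h⟩ := theorem3p3_general T L hT hL E N V hsol hE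
    (hN.of_le (by norm_num)) (hV.of_le (by norm_num)) CV
  exact ⟨C, hC, ε, hε, fun M K hM hK dt dx hdt hdx hdtε _ => h M K hM hK dt dx hdt hdx hdtε⟩
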